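/- Let $p$ be a prime. Let $G$ be an Abelian, second countable $p$-adic analytic Lie group with Lie algebra $\mathfrak g$ (the tangent space at the identity, with dual $\mathfrak g^*$), let $(M,\omega)$ be a paracompact (Hausdorff) $p$-adic analytic symplectic manifold, i.e. $\omega$ is a closed non-degenerate $p$-adic analytic $2$-form on $M$, and let $\psi:G\times M\to M$ be a $p$-adic analytic group action that is symplectic ($\psi(g,\cdot)^*\omega=\omega$ for all $g\in G$) and proper (whenever $(m_i)$ and $(\psi(g_i,m_i))$ are convergent sequences in $M$, the sequence $(g_i)$ in $G$ has a convergent subsequence). For $\xi\in\mathfrak g$ let $\mathrm X_\psi(\xi)$ be the vector field on $M$ whose value at $m$ is the image of $\xi$ under the differential at the identity of the orbit map $g\mapsto\psi(g,m)$. Call $\psi$ Hamiltonian if there is a $p$-adic analytic map $\mu:M\to\mathfrak g^*$ such that $\omega(\mathrm X_\psi(\xi),\cdot)=\mathrm d\langle\mu,\xi\rangle$ for all $\xi\in\mathfrak g$ and $\mu(\psi(g,m))=\mathrm{Ad}_g^*(\mu(m))$ for all $g\in G$, $m\in M$ (since $G$ is Abelian, $\mathrm{Ad}^*_g$ is the identity,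 so the last condition says that $\mu$ is constant on each orbit). Then $\psi$ is Hamiltonian if and only if $\omega(\mathrm X_\psi(\xi),\mathrm X_\psi(\eta))=0$ for all $\xi,\eta\in\mathfrak g$, that is, if and only if every $G$-orbit is isotropic (at each point $\psi(g,m)$ of the orbit, $\omega$ vanishes on the tangent space of the orbit, which is the range of the differential at $g$ of the orbit map $h\mapsto\psi(h,m)$). -/

import Mathlib

open scoped Manifold ContDiff Topology

noncomputable section

namespace PadicHamiltonian

section Forms

variable {𝕜 : Type*} [NontriviallyNormedField 𝕜]
  {E : Type*} [NormedAddCommGroup E] [NormedSpace 𝕜 E]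
  {E' : Type*} [NormedAddCommGroup E'] [NormedSpace 𝕜 E']

variable (𝕜 E) in
/-- A (not necessarily analytic) differential `2`-form on a manifold `M` modelled on `E`: an
alternating bilinear form on every tangent space. -/
abbrev TwoForm (M : Type*) [TopologicalSpace M] [ChartedSpace E M] : Type _ :=
  (m : M) → (TangentSpace 𝓘(𝕜, E) m) [⋀^Fin 2]→L[𝕜] 𝕜

variable {M : Type*} [TopologicalSpace M] [ChartedSpace E M]
  {N : Type*} [TopologicalSpace N] [ChartedSpace E' N]

/-- The pullback `f^* Ω` of a `2`-form along a map `f`. -/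
def TwoForm.pullback (f : N → M) (Ω : TwoForm 𝕜 E M) : TwoForm 𝕜 E' N := fun x ↦
  (Ω (f x)).compContinuousLinearMap (mfderiv 𝓘(𝕜, E') 𝓘(𝕜, E) f x)

/-- The expression of a `2`-form in the chart at `x₀`, as a function on the model space with values
in alternating forms: the pullback of the form by the inverse of the chart. It is meaningful on the
target of the chart. -/
def TwoForm.inChart (Ω : TwoForm 𝕜 E M) (x₀ : M) : E → E [⋀^Fin 2]→L[𝕜] 𝕜 :=
  fun y ↦ TwoForm.pullback (N := E) (chartAt E x₀).symm Ω y

/-- An analytic symplectic form: an analytic, closed and non-degenerate `2`-form. -/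
structure IsSymplecticForm (Ω : TwoForm 𝕜 E M) : Prop where
  analytic : ∀ x₀ : M, AnalyticOnNhd 𝕜 (Ω.inChart x₀) (chartAt E x₀).target
  closed : ∀ x₀ : M, ∀ y ∈ (chartAt E x₀).target, extDeriv (Ω.inChart x₀) y = 0
  nondegenerate : ∀ (m : M) (u : TangentSpace 𝓘(𝕜, E) m), u ≠ 0 →
    ∃ v : TangentSpace 𝓘(𝕜, E) m, Ω m ![u, v] ≠ 0

end Forms

section Actions

/-- A group action on a topological space is proper if, whenever `(m i)` and `(g i • m i)` converge,
the sequence `(g i)` has a convergent subsequence. -/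
def IsProperAction (G X : Type*) [Group G] [TopologicalSpace G] [TopologicalSpace X]
    [MulAction G X] : Prop :=
  ∀ (g : ℕ → G) (m : ℕ → X) (a b : X),
    Filter.Tendsto m Filter.atTop (𝓝 a) →
    Filter.Tendsto (fun i ↦ g i • m i) Filter.atTop (𝓝 b) →
    ∃ (φ : ℕ → ℕ) (h : G), StrictMono φ ∧ Filter.Tendsto (g ∘ φ) Filter.atTop (𝓝 h)

variable {𝕜 : Type*} [NontriviallyNormedField 𝕜]
  {F : Type*} [NormedAddCommGroup F] [NormedSpace 𝕜 F]
  {E : Type*} [NormedAddCommGroup E] [NormedSpace 𝕜 E]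
  (G : Type*) [Group G] [TopologicalSpace G] [ChartedSpace F G]
  {M : Type*} [TopologicalSpace M] [ChartedSpace E M] [MulAction G M]

/-- The action of `G` preserves the `2`-form `Ω`. -/
def IsSymplecticAction (Ω : TwoForm 𝕜 E M) : Prop :=
  ∀ g : G, TwoForm.pullback (fun m : M ↦ g • m) Ω = Ω

variable {G}

variable (𝕜 F E) in
/-- The derivative at `g` of the orbit map `h ↦ h • m`. -/
def orbitMapDeriv (m : M) (g : G) :
    TangentSpace 𝓘(𝕜, F) g →L[𝕜] TangentSpace 𝓘(𝕜, E) (g • m) :=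
  mfderiv 𝓘(𝕜, F) 𝓘(𝕜, E) (fun h : G ↦ h • m) g

variable (E) in
/-- The infinitesimal generator of the action in the direction of `ξ`: its value at `m` is the image
of `ξ` under the derivative at `1` of the orbit map `g ↦ g • m`. -/
def infinitesimalGenerator (ξ : GroupLieAlgebra 𝓘(𝕜, F) G) (m : M) : TangentSpace 𝓘(𝕜, E) m :=
  mfderiv 𝓘(𝕜, F) 𝓘(𝕜, E) (fun g : G ↦ g • m) 1 ξ

variable (𝕜 F) in
/-- The orbit of `m` is isotropic: at each of its points `g • m`, the form `Ω` vanishes on the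
tangent space of the orbit, which is the range of the derivative at `g` of the orbit map. -/
def IsIsotropicOrbit (G : Type*) [Group G] [TopologicalSpace G] [ChartedSpace F G] [MulAction G M]
    (Ω : TwoForm 𝕜 E M) (m : M) : Prop :=
  ∀ g : G, ∀ u ∈ (orbitMapDeriv 𝕜 F E m g).range, ∀ v ∈ (orbitMapDeriv 𝕜 F E m g).range,
    Ω (g • m) ![u, v] = 0

variable (𝕜 F) in
/-- The adjoint action: the derivative at `1` of conjugation `h ↦ g * h * g⁻¹`. -/
def Ad (g : G) : GroupLieAlgebra 𝓘(𝕜, F) G →L[𝕜] GroupLieAlgebra 𝓘(𝕜, F) G :=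
  (mfderiv 𝓘(𝕜, F) 𝓘(𝕜, F) (fun h : G ↦ g * h * g⁻¹) 1 : F →L[𝕜] F)

variable (𝕜 F) in
/-- The coadjoint action: `⟨Ad^*_g α, ξ⟩ = ⟨α, Ad_{g⁻¹} ξ⟩`. The dual of the Lie algebra is
written as the normed space of continuous linear forms on the model space `F`, which is the space
underlying the tangent space at `1`. -/
def coAd (g : G) (α : F →L[𝕜] 𝕜) : F →L[𝕜] 𝕜 :=
  α ∘L (Ad 𝕜 F g⁻¹ : F →L[𝕜] F)

/-- `μ` is an analytic momentum map for the action of `G` on `(M, Ω)`: it is analytic and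
`Ω(X(ξ), ·) = d μ_ξ` for all `ξ` in the Lie algebra, where `μ_ξ(m) = ⟨μ(m), ξ⟩`. -/
structure IsMomentumMap (G : Type*) [Group G] [TopologicalSpace G] [ChartedSpace F G]
    [MulAction G M] (Ω : TwoForm 𝕜 E M) (μ : M → (F →L[𝕜] 𝕜)) : Prop where
  analytic : ContMDiff 𝓘(𝕜, E) 𝓘(𝕜, F →L[𝕜] 𝕜) ω μ
  hamilton : ∀ (ξ : GroupLieAlgebra 𝓘(𝕜, F) G) (m : M) (v : TangentSpace 𝓘(𝕜, E) m),
    Ω m ![infinitesimalGenerator E ξ m, v] =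
      mfderiv 𝓘(𝕜, E) 𝓘(𝕜, 𝕜) (fun x : M ↦ μ x ξ) m v

variable (F) in
/-- The action of `G` on `(M, Ω)` is Hamiltonian: it has a momentum map which is equivariant for the
coadjoint action. -/
def IsHamiltonian (G : Type*) [Group G] [TopologicalSpace G] [ChartedSpace F G] [MulAction G M]
    (Ω : TwoForm 𝕜 E M) : Prop :=
  ∃ μ : M → (F →L[𝕜] 𝕜), IsMomentumMap G Ω μ ∧
    ∀ (g : G) (m : M), μ (g • m) = coAd 𝕜 F g (μ m)

end Actions

end PadicHamiltonian

end

/-! ### Power series and the Euler operator -/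

section PowerSeries

variable {𝕜 : Type*} [NontriviallyNormedField 𝕜]
  {E : Type*} [NormedAddCommGroup E] [NormedSpace 𝕜 E]
  {V : Type*} [NormedAddCommGroup V] [NormedSpace 𝕜 V]

/-! A momentum map of an Abelian group is constant on orbits, so the derivative of `μ_ξ` kills every
generator `X(η)`, and by Hamilton's equation this derivative is `Ω(X(ξ), X(η))`. That is the easy
direction, `IsHamiltonian.eval_infinitesimalGenerator`.

For the converse, invariance and closedness of `Ω` make the contraction of `Ω` with the generators a
closed `1`-form with values in the dual of the Lie algebra (`fderiv_contractGenerator_symm`). The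
analytic Poincaré lemma (`AnalyticAt.exists_primitive`) then gives local solutions `ν` of Hamilton's
equation. If the generators are mutually orthogonal, `(g, x) ↦ ν (g • x) - ν x` has zero derivative
near `(h, x₀)` whenever `h` fixes `x₀`. An analytic function with zero derivative is locally
constant, so this one vanishes near `(h, x₀)` (`eventually_smul_eq_of_isMomentumMapAt`). Properness
turns this into a compact open neighbourhood `V` of `x₀` such that `ν` agrees at any two points of
`V` on the same orbit (`exists_invariant_isMomentumMapAt`). Hence `ν` extends to an invariant
solution on the saturation of `V`.

These saturations are open, and closed by properness. Since the manifold is totally disconnected,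
local solutions need not match on overlaps: it suffices to choose one of them at each point in an
invariant and locally constant way. Paracompactness and a countable dense subset of `G` make this
possible (`exists_invariant_locallyConstant_selection`). -/

theorem AnalyticAt.continuousLinearMap_apply {W : Type*} [NormedAddCommGroup W] [NormedSpace 𝕜 W]
    {f : E → W →L[𝕜] V} {g : E → W} {x : E} (hf : AnalyticAt 𝕜 f x) (hg : AnalyticAt 𝕜 g x) :
    AnalyticAt 𝕜 (fun y ↦ f y (g y)) x :=
  ((ContinuousLinearMap.id 𝕜 (W →L[𝕜] V)).analyticAt_bilinear (f x, g x)).comp₂ hf hg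

/-- Multiplying the terms of a convergent power series by scalars of at most linear growth keeps it
convergent. -/
theorem FormalMultilinearSeries.radius_pos_of_linear_growth
    {q : FormalMultilinearSeries 𝕜 E V} (hq : 0 < q.radius) (c : ℕ → 𝕜)
    (hc : ∀ n, ‖c n‖ ≤ n + 1) :
    0 < FormalMultilinearSeries.radius (fun n ↦ c n • q n) := by
  obtain ⟨r, hr0, hr⟩ := ENNReal.lt_iff_exists_nnreal_btwn.1 hq
  obtain ⟨a, ha, C, hC, h⟩ := q.norm_mul_pow_le_mul_pow_of_lt_radius hr
  have ht : Filter.Tendsto (fun n : ℕ ↦ (n : ℝ) * a ^ n + a ^ n) Filter.atTop (𝓝 (0 + 0)) :=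
    (tendsto_self_mul_const_pow_of_lt_one ha.1.le ha.2).add
      (tendsto_pow_atTop_nhds_zero_of_lt_one ha.1.le ha.2)
  obtain ⟨B, hB⟩ := ht.bddAbove_range
  refine hr0.trans_le (FormalMultilinearSeries.le_radius_of_bound _ (C * B) fun n ↦ ?_)
  have h1 : (n : ℝ) * a ^ n + a ^ n ≤ B := hB ⟨n, rfl⟩
  calc ‖c n • q n‖ * (r : ℝ) ^ n = ‖c n‖ * (‖q n‖ * r ^ n) := by rw [norm_smul]; ring
    _ ≤ (n + 1) * (C * a ^ n) := mul_le_mul (hc n) (h n) (by positivity) (by positivity)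
    _ = C * ((n : ℝ) * a ^ n + a ^ n) := by ring
    _ ≤ C * B := by gcongr

/-- The Euler operator multiplies the homogeneous term of degree `n` by `n`. -/
theorem HasFPowerSeriesAt.eventually_hasSum_fderiv_apply_self [CompleteSpace V] {f : E → V}
    {q : FormalMultilinearSeries 𝕜 E V} (hf : HasFPowerSeriesAt f q 0) :
    ∀ᶠ y in 𝓝 (0 : E), HasSum (fun n : ℕ ↦ (n : 𝕜) • q n fun _ ↦ y) (fderiv 𝕜 f y y) := by
  obtain ⟨r, hr⟩ := hf
  have h := hr.fderiv.hasFPowerSeriesAt.eventually_hasSum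
  filter_upwards [h] with y hy
  rw [zero_add] at hy
  have := hy.mapL (ContinuousLinearMap.apply 𝕜 V y)
  simp only [ContinuousLinearMap.apply_apply, FormalMultilinearSeries.derivSeries_apply_diag]
    at this
  -- The term `n = 0` has coefficient zero, and the derivative series is indexed from the linear
  -- term of `q`.
  rw [← hasSum_nat_add_iff' 1]
  simpa [Nat.cast_smul_eq_nsmul, ← Nat.cast_succ, -Nat.cast_add] using this

end PowerSeries

/-! ### Euler equations over `ℚ_[p]` and the Poincaré lemma -/

section Padic

variable {p : ℕ} [Fact p.Prime]
  {E : Type*} [NormedAddCommGroup E] [NormedSpace ℚ_[p] E]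
  {V : Type*} [NormedAddCommGroup V] [NormedSpace ℚ_[p] V] [CompleteSpace V]

/-- The power of `p` dividing `n` is at most `n`. Hence integrating a power series, which introduces
denominators `n + 1`, costs only a factor of linear growth. -/
theorem Padic.norm_natCast_inv_le (n : ℕ) (hn : n ≠ 0) : ‖((n : ℚ_[p]))⁻¹‖ ≤ n := by
  have h0 : ((n : ℤ) : ℚ_[p]) ≠ 0 := by exact_mod_cast hn
  have hpos : 0 < ‖(n : ℚ_[p])‖ := norm_pos_iff.2 (by exact_mod_cast hn)
  rw [norm_inv, Padic.norm_eq_zpow_neg_valuation (by exact_mod_cast hn), Padic.valuation_natCast,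
    zpow_neg, inv_inv, zpow_natCast]
  exact_mod_cast Nat.le_of_dvd (Nat.pos_of_ne_zero hn) pow_padicValNat_dvd

/-- On germs of analytic functions, the Euler operator plus one is onto. -/
theorem AnalyticAt.exists_fderiv_apply_self_add_eq {f : E → V} (hf : AnalyticAt ℚ_[p] f 0) :
    ∃ g : E → V, AnalyticAt ℚ_[p] g 0 ∧ ∀ᶠ y in 𝓝 0, fderiv ℚ_[p] g y y + g y = f y := by
  obtain ⟨q, hq⟩ := hf
  let q' : FormalMultilinearSeries ℚ_[p] E V := fun n ↦ ((n + 1 : ℕ) : ℚ_[p])⁻¹ • q n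
  have hr : 0 < q'.radius := FormalMultilinearSeries.radius_pos_of_linear_growth hq.radius_pos _
    fun n ↦ by simpa using Padic.norm_natCast_inv_le (p := p) (n + 1) n.succ_ne_zero
  have hq' : HasFPowerSeriesAt q'.sum q' 0 := (q'.hasFPowerSeriesOnBall hr).hasFPowerSeriesAt
  refine ⟨q'.sum, ⟨q', hq'⟩, ?_⟩
  filter_upwards [hq'.eventually_hasSum_fderiv_apply_self, hq'.eventually_hasSum,
    hq.eventually_hasSum] with y h1 h2 h3
  rw [zero_add] at h2 h3
  refine (h1.add h2).unique (h3.congr_fun fun n ↦ ?_)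
  have h0 : ((n : ℚ_[p]) + 1) ≠ 0 := by exact_mod_cast n.succ_ne_zero
  have h4 : q' n (fun _ ↦ y) = ((n : ℚ_[p]) + 1)⁻¹ • q n fun _ ↦ y := by simp [q']
  rw [h4, smul_smul, ← add_smul, ← add_one_mul, mul_inv_cancel₀ h0, one_smul]

/-- The Euler operator plus `c` multiplies the term of degree `n` by `n + c`, which is nonzero in
characteristic zero. The case `c = 1` gives uniqueness in the Poincaré lemma; `c = 0` gives local
constancy when the derivative vanishes. The terms of `q` need not be symmetric, so only their
diagonal values are determined. -/
theorem HasFPowerSeriesAt.apply_eq_zero_of_fderiv_apply_self {f : E → V}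
    {q : FormalMultilinearSeries ℚ_[p] E V} (hq : HasFPowerSeriesAt f q 0) (c : ℕ)
    (h : ∀ᶠ y in 𝓝 (0 : E), fderiv ℚ_[p] f y y + (c : ℚ_[p]) • f y = 0) (n : ℕ)
    (hn : n + c ≠ 0) (y : E) : q n (fun _ ↦ y) = 0 := by
  let q' : FormalMultilinearSeries ℚ_[p] E V := fun n ↦ ((n + c : ℕ) : ℚ_[p]) • q n
  have hr : 0 < q'.radius := FormalMultilinearSeries.radius_pos_of_linear_growth hq.radius_pos _
    fun n ↦ (IsUltrametricDist.norm_natCast_le_one ℚ_[p] (n + c)).trans (by simp)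
  have hq' : HasFPowerSeriesAt q'.sum q' 0 := (q'.hasFPowerSeriesOnBall hr).hasFPowerSeriesAt
  have h0 : q'.sum =ᶠ[𝓝 0] 0 := by
    filter_upwards [hq.eventually_hasSum_fderiv_apply_self, hq'.eventually_hasSum,
      hq.eventually_hasSum, h] with y h1 h2 h3 h4
    rw [zero_add] at h2 h3
    have := h1.add (h3.const_smul (c : ℚ_[p]))
    rw [h4] at this
    refine h2.unique (this.congr_fun ?_)
    intro n
    simp [q', add_smul]
  have h1 : ((n + c : ℕ) : ℚ_[p]) • q n (fun _ ↦ y) = 0 := (hq'.congr h0).apply_eq_zero n y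
  exact (smul_eq_zero.1 h1).resolve_left (by exact_mod_cast hn)

theorem AnalyticAt.eventuallyEq_zero_of_fderiv_apply_self {f : E → V}
    (hf : AnalyticAt ℚ_[p] f 0) (h : ∀ᶠ y in 𝓝 (0 : E), fderiv ℚ_[p] f y y + f y = 0) :
    f =ᶠ[𝓝 0] 0 := by
  obtain ⟨q, hq⟩ := hf
  filter_upwards [hq.eventually_hasSum] with y hy
  rw [zero_add] at hy
  refine hy.unique ?_
  simp_rw [hq.apply_eq_zero_of_fderiv_apply_self 1 (by simpa using h) _ (Nat.succ_ne_zero _) y]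
  exact hasSum_zero

/-- A `p`-adic analytic function with vanishing derivative is locally constant. -/
theorem AnalyticAt.eventually_eq_of_fderiv_eq_zero {f : E → V} {x : E}
    (hf : AnalyticAt ℚ_[p] f x) (h : ∀ᶠ y in 𝓝 x, fderiv ℚ_[p] f y = 0) :
    ∀ᶠ y in 𝓝 x, f y = f x := by
  have hT : Filter.Tendsto (fun y : E ↦ x + y) (𝓝 0) (𝓝 x) := by
    simpa using (continuous_const_add x).tendsto 0
  have hT' : Filter.Tendsto (fun y : E ↦ y - x) (𝓝 x) (𝓝 0) := by
    simpa using (continuous_sub_right x).tendsto x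
  have hg : AnalyticAt ℚ_[p] (fun y ↦ f (x + y)) 0 :=
    AnalyticAt.fun_comp (by simpa using hf) (by fun_prop)
  obtain ⟨q, hq⟩ := hg
  have h0 : ∀ᶠ y in 𝓝 (0 : E), f (x + y) = f x := by
    filter_upwards [hq.eventually_hasSum] with y hy
    rw [zero_add] at hy
    refine hy.unique ?_
    have hz (n : ℕ) (hn : n ≠ 0) : q n (fun _ ↦ y) = 0 := by
      refine hq.apply_eq_zero_of_fderiv_apply_self 0 ?_ n hn y
      filter_upwards [hT.eventually h] with z hz
      simp [fderiv_comp_add_left, hz]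
    convert hasSum_single 0 hz
    rw [hq.coeff_zero, add_zero]
  filter_upwards [hT'.eventually h0] with y hy
  simpa using hy

/-- The classical homotopy primitive, with the integral `∫₀¹ α (t y) dt` replaced by the solution
`β` of the Euler equation `β' y + β = α`; the primitive is `f y = β y y`. The error `γ = α - df`
satisfies `γ y y = 0`. Differentiating this and using the symmetry of `dγ` gives `γ' y + γ = 0`, so
`γ` vanishes near `0`. -/
theorem AnalyticAt.exists_primitive_zero {α : E → E →L[ℚ_[p]] V} (hα : AnalyticAt ℚ_[p] α 0)
    (hcl : ∀ᶠ y in 𝓝 (0 : E), ∀ u v, fderiv ℚ_[p] α y u v = fderiv ℚ_[p] α y v u) :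
    ∃ f : E → V, AnalyticAt ℚ_[p] f 0 ∧ ∀ᶠ y in 𝓝 0, fderiv ℚ_[p] f y = α y := by
  obtain ⟨β, hβ, hβα⟩ := hα.exists_fderiv_apply_self_add_eq
  have hf : AnalyticAt ℚ_[p] (fun y ↦ β y y) 0 := hβ.continuousLinearMap_apply analyticAt_id
  refine ⟨_, hf, ?_⟩
  have hγ : AnalyticAt ℚ_[p] (fun y ↦ α y - fderiv ℚ_[p] (fun y ↦ β y y) y) 0 := hα.sub hf.fderiv
  have hz : ∀ᶠ y in 𝓝 (0 : E), (α y - fderiv ℚ_[p] (fun y ↦ β y y) y) y = 0 := by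
    filter_upwards [hβα, hβ.eventually_analyticAt] with y h1 h2
    have h3 := (h2.differentiableAt.hasFDerivAt.clm_apply (hasFDerivAt_id y)).fderiv
    simp only [id] at h3
    simp [h3, ← h1]
    abel
  have := hγ.eventuallyEq_zero_of_fderiv_apply_self ?_
  · filter_upwards [this] with y hy
    exact (sub_eq_zero.1 hy).symm
  filter_upwards [hz.eventually_nhds, hcl, hα.eventually_analyticAt, hf.eventually_analyticAt]
    with y h1 h2 h3 h4
  have hd : DifferentiableAt ℚ_[p] (fun y ↦ α y - fderiv ℚ_[p] (fun y ↦ β y y) y) y :=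
    (h3.sub h4.fderiv).differentiableAt
  ext v
  have h5 := (hd.hasFDerivAt.clm_apply (hasFDerivAt_id y)).fderiv
  have h6 : fderiv ℚ_[p] (fun z ↦ (α z - fderiv ℚ_[p] (fun y ↦ β y y) z) z) y = 0 := by
    have h6 : (fun z ↦ (α z - fderiv ℚ_[p] (fun y ↦ β y y) z) z) =ᶠ[𝓝 y] fun _ ↦ (0 : V) := h1
    rw [h6.fderiv_eq]
    simp
  have h7 := DFunLike.congr_fun (h5.symm.trans h6) v
  have hsub : fderiv ℚ_[p] (fun y ↦ α y - fderiv ℚ_[p] (fun y ↦ β y y) y) y =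
      fderiv ℚ_[p] α y - fderiv ℚ_[p] (fderiv ℚ_[p] (fun y ↦ β y y)) y :=
    fderiv_fun_sub h3.differentiableAt h4.fderiv.differentiableAt
  have hs := (h4.contDiffAt (n := ω)).isSymmSndFDerivAt_of_omega
  rw [hsub] at h7 ⊢
  simp only [id, add_apply, sub_apply, ContinuousLinearMap.comp_apply,
    ContinuousLinearMap.flip_apply, zero_apply, ContinuousLinearMap.id_apply] at h7 ⊢
  rw [h2 y v, hs.eq y v]
  simpa [add_comm] using h7

/-- The `p`-adic analytic Poincaré lemma for `1`-forms. -/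
theorem AnalyticAt.exists_primitive {α : E → E →L[ℚ_[p]] V} {x : E} (hα : AnalyticAt ℚ_[p] α x)
    (hcl : ∀ᶠ y in 𝓝 x, ∀ u v, fderiv ℚ_[p] α y u v = fderiv ℚ_[p] α y v u) :
    ∃ f : E → V, AnalyticAt ℚ_[p] f x ∧ ∀ᶠ y in 𝓝 x, fderiv ℚ_[p] f y = α y := by
  have hT : Filter.Tendsto (fun y : E ↦ x + y) (𝓝 0) (𝓝 x) := by
    simpa using (continuous_const_add x).tendsto 0
  have hT' : Filter.Tendsto (fun y : E ↦ y - x) (𝓝 x) (𝓝 0) := by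
    simpa using (continuous_sub_right x).tendsto x
  obtain ⟨f, hf, hfα⟩ := AnalyticAt.exists_primitive_zero (α := fun y ↦ α (x + y))
    (AnalyticAt.fun_comp (by simpa using hα) (by fun_prop))
    (by filter_upwards [hT.eventually hcl] with y hy; simpa [fderiv_comp_add_left] using hy)
  refine ⟨fun y ↦ f (y - x), AnalyticAt.fun_comp (by simpa using hf) (by fun_prop), ?_⟩
  filter_upwards [hT'.eventually hfα] with y hy
  simpa [fderiv_comp_sub] using hy

end Padic

/-! ### Closedness of the contraction with the generators -/

section LieDerivative

variable {𝕜 : Type*} [NontriviallyNormedField 𝕜]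
  {E : Type*} [NormedAddCommGroup E] [NormedSpace 𝕜 E]
  {F : Type*} [NormedAddCommGroup F] [NormedSpace 𝕜 F]

/-- The contraction of the bilinear forms `w` with the generators of the local flow `A` at the
parameter `s`. -/
noncomputable def contractGenerator (w : E → E →L[𝕜] E →L[𝕜] 𝕜) (A : F × E → E) (s : F) (y : E) :
    E →L[𝕜] F →L[𝕜] 𝕜 :=
  (w y ∘L fderiv 𝕜 A (s, y) ∘L ContinuousLinearMap.inl 𝕜 F E).flip

variable [CompleteSpace E] {w : E → E →L[𝕜] E →L[𝕜] 𝕜} {A : F × E → E} {s : F} {y₀ : E}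

theorem analyticAt_contractGenerator [CompleteSpace 𝕜] (hw : AnalyticAt 𝕜 w y₀)
    (hA : AnalyticAt 𝕜 A (s, y₀)) : AnalyticAt 𝕜 (contractGenerator w A s) y₀ := by
  have h1 : ContDiffAt 𝕜 ω (fun y ↦ fderiv 𝕜 A (s, y)) y₀ :=
    ContDiffAt.comp y₀ (g := fderiv 𝕜 A) hA.fderiv.contDiffAt (by fun_prop)
  have h2 := (hw.contDiffAt (n := ω)).clm_comp (h1.clm_comp (contDiffAt_const (c := ContinuousLinearMap.inl 𝕜 F E)))
  have hf : ContDiff 𝕜 ω (ContinuousLinearMap.flipₗᵢ 𝕜 F E 𝕜) := LinearIsometryEquiv.contDiff _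
  exact (hf.contDiffAt.comp y₀ h2).analyticAt

theorem fderiv_contractGenerator {y : E} (hw : DifferentiableAt 𝕜 w y)
    (hA : AnalyticAt 𝕜 A (s, y)) (u v : E) (ξ : F)
    (hd : DifferentiableAt 𝕜 (contractGenerator w A s) y) :
    fderiv 𝕜 (contractGenerator w A s) y u v ξ =
      fderiv 𝕜 w y u (fderiv 𝕜 A (s, y) (ξ, 0)) v +
        w y (fderiv 𝕜 (fderiv 𝕜 A) (s, y) (0, u) (ξ, 0)) v := by
  have h1 := (hd.hasFDerivAt.clm_apply (hasFDerivAt_const v y)).clm_apply (hasFDerivAt_const ξ y)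
  have hi : HasFDerivAt (fun y : E ↦ (s, y)) (ContinuousLinearMap.inr 𝕜 F E) y :=
    hasFDerivAt_prodMk_right s y
  have h2 := (hw.hasFDerivAt.clm_apply ((hA.fderiv.differentiableAt.hasFDerivAt.comp y hi).clm_apply
    (hasFDerivAt_const (ξ, (0 : E)) y))).clm_apply (hasFDerivAt_const v y)
  have h3 := DFunLike.congr_fun (h1.unique h2) u
  simpa [add_comm] using h3

/-- Contracting a closed form, invariant under a flow, with the generators of the flow gives a
closed form. -/
theorem fderiv_contractGenerator_symm [CompleteSpace 𝕜] (hw : AnalyticAt 𝕜 w y₀) (hA : AnalyticAt 𝕜 A (s, y₀))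
    (hA0 : ∀ᶠ y in 𝓝 y₀, A (s, y) = y)
    (hinv : ∀ᶠ z in 𝓝 (s, y₀), ∀ u v,
      w (A z) (fderiv 𝕜 A z (0, u)) (fderiv 𝕜 A z (0, v)) = w z.2 u v)
    (halt : ∀ y u v, w y u v = - w y v u)
    (hcl : ∀ᶠ y in 𝓝 y₀, ∀ u v t,
      fderiv 𝕜 w y u v t - fderiv 𝕜 w y v u t + fderiv 𝕜 w y t u v = 0) :
    ∀ᶠ y in 𝓝 y₀, ∀ u v, fderiv 𝕜 (contractGenerator w A s) y u v =
      fderiv 𝕜 (contractGenerator w A s) y v u := by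
  have hT : Filter.Tendsto (fun y : E ↦ (s, y)) (𝓝 y₀) (𝓝 (s, y₀)) :=
    (Continuous.prodMk_right s).tendsto y₀
  filter_upwards [hw.eventually_analyticAt, hT.eventually hA.eventually_analyticAt,
    hA0.eventually_nhds, hT.eventually hinv.eventually_nhds, hcl] with y hw hA hA0 hinv hcl
  intro u v
  ext ξ
  have hd := (analyticAt_contractGenerator hw hA).differentiableAt
  rw [fderiv_contractGenerator hw.differentiableAt hA _ _ _ hd,
    fderiv_contractGenerator hw.differentiableAt hA _ _ _ hd]
  have hy : A (s, y) = y := hA0.self_of_nhds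
  have hi : HasFDerivAt (fun y : E ↦ (s, y)) (ContinuousLinearMap.inr 𝕜 F E) y :=
    hasFDerivAt_prodMk_right s y
  have hid (u : E) : fderiv 𝕜 A (s, y) (0, u) = u := by
    have h1 := hA.differentiableAt.hasFDerivAt.comp y hi
    have h2 : HasFDerivAt (A ∘ fun y ↦ (s, y)) (ContinuousLinearMap.id 𝕜 E) y :=
      (hasFDerivAt_id y).congr_of_eventuallyEq hA0
    exact DFunLike.congr_fun (h1.unique h2) u
  have hS := (hA.contDiffAt (n := ω)).isSymmSndFDerivAt_of_omega
  have hw' : HasFDerivAt w (fderiv 𝕜 w y) (A (s, y)) := by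
    rw [hy]; exact hw.differentiableAt.hasFDerivAt
  have hwA : HasFDerivAt (fun z ↦ w (A z)) (fderiv 𝕜 w y ∘L fderiv 𝕜 A (s, y)) (s, y) :=
    HasFDerivAt.comp (g := w) (f := A) (s, y) hw' hA.differentiableAt.hasFDerivAt
  have hDA (b : E) := hA.fderiv.differentiableAt.hasFDerivAt.clm_apply
    (hasFDerivAt_const ((0 : F), b) (s, y))
  have hlhs := (hwA.clm_apply (hDA u)).clm_apply (hDA v)
  have hrhs := (((hw.differentiableAt.hasFDerivAt.comp (s, y)
    (hasFDerivAt_snd (𝕜 := 𝕜) (p := (s, y)))).clm_apply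
    (hasFDerivAt_const u (s, y))).clm_apply (hasFDerivAt_const v (s, y)))
  -- The invariance equation differentiated in the direction `(ξ, 0)` of the parameter: the Lie
  -- derivative of `w` along the generator vanishes. The right-hand side does not involve the
  -- parameter.
  have h1 := DFunLike.congr_fun (hlhs.unique (hrhs.congr_of_eventuallyEq
    (by filter_upwards [hinv] with z hz; exact hz u v))) (ξ, 0)
  simp [hy, hid] at h1
  have h2 := hcl u v (fderiv 𝕜 A (s, y) (ξ, 0))
  have h3 (a b c : E) : fderiv 𝕜 w y a b c = - fderiv 𝕜 w y a c b := by
    have h4 := ((hw.differentiableAt.hasFDerivAt.clm_apply (hasFDerivAt_const b y)).clm_apply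
      (hasFDerivAt_const c y))
    have h5 := ((hw.differentiableAt.hasFDerivAt.clm_apply (hasFDerivAt_const c y)).clm_apply
      (hasFDerivAt_const b y)).neg
    have h6 := DFunLike.congr_fun (h4.unique (h5.congr_of_eventuallyEq
      (by filter_upwards with z; exact halt z b c))) a
    simpa using h6
  -- Symmetry of the second derivative of `A` turns the space derivative of the generator into the
  -- mixed derivative occurring in `h1`; the rest is Cartan's formula.
  rw [hS.eq (0, u), hS.eq (0, v)]
  rw [h3 u _ v, h3 v _ u, halt y _ u]
  linear_combination h1 - h2

end LieDerivative

/-! ### Invariant, locally constant selection of neighbourhoods -/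

section Topology

theorem Relation.countable_setOf_reflTransGen {α : Type*} {r : α → α → Prop}
    (h : ∀ a, {b | r a b}.Countable) (a : α) : {b | Relation.ReflTransGen r a b}.Countable := by
  let S : ℕ → Set α := fun n ↦ Nat.rec {a} (fun _ T ↦ ⋃ c ∈ T, {b | r c b}) n
  have hS (n : ℕ) : (S n).Countable := by
    induction n with
    | zero => exact Set.countable_singleton a
    | succ n ih => exact ih.biUnion fun c _ ↦ h c
  refine (Set.countable_iUnion hS).mono fun b hb ↦ ?_
  induction hb with
  | refl => exact Set.mem_iUnion.2 ⟨0, rfl⟩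
  | tail _ hbc ih =>
    obtain ⟨n, hn⟩ := Set.mem_iUnion.1 ih
    exact Set.mem_iUnion.2 ⟨n + 1, Set.mem_biUnion hn hbc⟩

variable {G X : Type*} [Group G] [TopologicalSpace X] [MulAction G X]

theorem isOpen_setOf_exists_smul_mem [ContinuousConstSMul G X] {V : Set X} (hV : IsOpen V) :
    IsOpen {x | ∃ g : G, g • x ∈ V} := by
  simp only [Set.ofPred_exists]
  exact isOpen_iUnion fun g ↦ hV.preimage (continuous_const_smul g)

variable [TopologicalSpace G]

/-- If `x i` converges and `g i • x i ∈ V`, compactness makes a subsequence of `g i • x i` converge;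
properness then makes a further subsequence of `g i` converge, and its limit carries the limit of `x
i` into `V`. -/
theorem PadicHamiltonian.IsProperAction.isClosed_setOf_exists_smul_mem [ContinuousSMul G X]
    [T2Space X] [FirstCountableTopology X] (h : PadicHamiltonian.IsProperAction G X) {V : Set X}
    (hV : IsCompact V) : IsClosed {x | ∃ g : G, g • x ∈ V} := by
  refine IsSeqClosed.isClosed fun x a hx ha ↦ ?_
  choose g hg using hx
  obtain ⟨v, hv, φ, hφ, hlim⟩ := hV.isSeqCompact hg
  have hxφ := ha.comp hφ.tendsto_atTop
  obtain ⟨θ, k, hθ, hk⟩ := h (g ∘ φ) (x ∘ φ) a v hxφ hlim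
  have h1 := hk.smul (hxφ.comp hθ.tendsto_atTop)
  exact ⟨k, tendsto_nhds_unique h1 (hlim.comp hθ.tendsto_atTop) ▸ hv⟩

/-- If every point of a paracompact space has a compact open neighbourhood with closed saturation,
these neighbourhoods can be selected in an invariant, locally constant way. -/
theorem exists_invariant_locallyConstant_selection [ContinuousSMul G X]
    [TopologicalSpace.SeparableSpace G] [ParacompactSpace X] [T2Space X] (V : X → Set X)
    (hVo : ∀ a, IsOpen (V a)) (hVc : ∀ a, IsCompact (V a)) (hV : ∀ a, a ∈ V a)
    (hVs : ∀ a, IsClosed {x | ∃ g : G, g • x ∈ V a}) :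
    ∃ s : X → X, (∀ x, ∃ g : G, g • x ∈ V (s x)) ∧ (∀ (g : G) x, s (g • x) = s x) ∧
      ∀ x, ∀ᶠ y in 𝓝 x, s y = s x := by
  rcases isEmpty_or_nonempty X with _ | ⟨⟨x₀⟩⟩
  · exact ⟨id, isEmptyElim, fun _ ↦ isEmptyElim, isEmptyElim⟩
  obtain ⟨β, t, hto, htu, htf, htV⟩ := ParacompactSpace.locallyFinite_refinement X V hVo
    (Set.eq_univ_of_forall fun a ↦ Set.mem_iUnion.2 ⟨a, hV a⟩)
  choose a ha using htV
  let r : β → β → Prop := fun b c ↦ ∃ (g : G) (x : X), x ∈ t b ∧ g • x ∈ t c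
  have hrsymm : ∀ b c, r b c → r c b := by
    rintro b c ⟨g, x, hx, hgx⟩
    exact ⟨g⁻¹, g • x, hgx, by simpa using hx⟩
  have hr (b : β) : {c | r b c}.Countable := by
    have hD := TopologicalSpace.exists_countable_dense G
    obtain ⟨D, hDc, hD⟩ := hD
    have hfin (d : G) : {c | (t c ∩ {y | d • y ∈ V (a b)}).Nonempty}.Finite := by
      refine htf.finite_nonempty_inter_compact ?_
      convert (hVc (a b)).image (continuous_const_smul d⁻¹) using 1
      ext y
      simp only [Set.mem_ofPred_eq, Set.mem_image]
      exact ⟨fun hy ↦ ⟨_, hy, by simp⟩, by rintro ⟨z, hz, rfl⟩; simpa using hz⟩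
    -- Some `g⁻¹` brings a point of `t c` back into the open set `V (a b)`, so some `d` in the dense
    -- set `D` does too. For fixed `d`, only finitely many members of the locally finite cover meet
    -- the compact set `d⁻¹ • V (a b)`.
    refine (hDc.biUnion fun d _ ↦ (hfin d).countable).mono ?_
    rintro c ⟨g, x, hx, hgx⟩
    have hopen : IsOpen {d : G | d • g • x ∈ V (a b)} :=
      (hVo (a b)).preimage (continuous_id.smul continuous_const)
    obtain ⟨d, hd, hdD⟩ := hD.inter_open_nonempty _ hopen ⟨g⁻¹, by simpa using ha b hx⟩
    exact Set.mem_biUnion hdD ⟨g • x, hgx, hd⟩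
  have hex (x : X) : ∃ b, x ∈ t b := by
    simpa using Set.mem_iUnion.1 (htu ▸ Set.mem_univ x : x ∈ ⋃ b, t b)
  choose b hb using hex
  -- The choice of `b x` is arbitrary, but its class under the relation generated by `r` is
  -- invariant and locally constant.
  let C : X → Set β := fun x ↦ {c | Relation.ReflTransGen r (b x) c}
  have hCr {x y : X} (h : r (b x) (b y)) : C y = C x := by
    ext c
    exact ⟨fun hc ↦ hc.head h, fun hc ↦ hc.head (hrsymm _ _ h)⟩
  have hCt {x y : X} (h : y ∈ t (b x)) : C y = C x := hCr ⟨1, y, h, by simpa using hb y⟩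
  have hCg (g : G) (x : X) : C (g • x) = C x := hCr ⟨g, x, hb x, hb _⟩
  have hCc (x : X) : ∃ e : ℕ → β, C x = Set.range e :=
    (Relation.countable_setOf_reflTransGen hr (b x)).exists_eq_range ⟨b x, .refl⟩
  -- The enumeration depends on the class only, not on the point, so it inherits invariance and
  -- local constancy.
  have hCe : ∃ e : Set β → ℕ → β, ∀ x, C x = Set.range (e (C x)) := by
    have h1 (T : Set β) : ∃ e : ℕ → β, T ∈ Set.range C → T = Set.range e := by
      by_cases hT : T ∈ Set.range C
      · obtain ⟨x, rfl⟩ := hT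
        exact (hCc x).imp fun e he _ ↦ he
      · exact ⟨fun _ ↦ b x₀, fun h ↦ absurd h hT⟩
    choose e he using h1
    exact ⟨e, fun x ↦ he _ ⟨x, rfl⟩⟩
  obtain ⟨e, he⟩ := hCe
  let W : ℕ → X → Prop := fun n x ↦ ∃ g : G, g • x ∈ V (a (e (C x) n))
  have hW (x : X) : ∃ n, W n x := by
    have h1 : b x ∈ Set.range (e (C x)) := he x ▸ Relation.ReflTransGen.refl
    obtain ⟨n, hn⟩ := h1
    exact ⟨n, 1, by simpa [hn] using ha _ (hb x)⟩
  classical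
  have hWg (g : G) (x : X) (n : ℕ) : W n (g • x) ↔ W n x := by
    simp only [W, hCg]
    constructor
    · rintro ⟨k, hk⟩
      exact ⟨k * g, by rwa [mul_smul]⟩
    · rintro ⟨k, hk⟩
      exact ⟨k * g⁻¹, by simpa [mul_smul] using hk⟩
  have hWe (x : X) (n : ℕ) : ∀ᶠ y in 𝓝 x, (W n y ↔ W n x) := by
    have h1 : IsClopen {y | ∃ g : G, g • y ∈ V (a (e (C x) n))} :=
      ⟨hVs _, isOpen_setOf_exists_smul_mem (hVo _)⟩
    have h2 : ∀ᶠ y in 𝓝 x, (y ∈ {y | ∃ g : G, g • y ∈ V (a (e (C x) n))} ↔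
        x ∈ {y | ∃ g : G, g • y ∈ V (a (e (C x) n))}) := by
      by_cases hx : x ∈ {y | ∃ g : G, g • y ∈ V (a (e (C x) n))}
      · filter_upwards [h1.isOpen.mem_nhds hx] with y hy
        exact iff_of_true hy hx
      · filter_upwards [h1.compl.isOpen.mem_nhds hx] with y hy
        exact iff_of_false hy hx
    filter_upwards [h2, (hto (b x)).mem_nhds (hb x)] with y hy hyt
    simp only [W, hCt hyt]
    exact hy
  refine ⟨fun x ↦ a (e (C x) (Nat.find (hW x))), fun x ↦ Nat.find_spec (hW x), fun g x ↦ ?_,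
    fun x ↦ ?_⟩
  · have : Nat.find (hW (g • x)) = Nat.find (hW x) := by
      apply Nat.find_congr'
      exact hWg g x _
    simp only [this, hCg]
  -- The least index is decided by finitely many conditions, each locally constant because the
  -- saturations are clopen.
  · have h1 : ∀ᶠ y in 𝓝 x, ∀ n ∈ Finset.range (Nat.find (hW x) + 1), (W n y ↔ W n x) := by
      rw [Filter.eventually_all_finset]
      exact fun n _ ↦ hWe x n
    filter_upwards [h1, (hto (b x)).mem_nhds (hb x)] with y hy hyt
    have : Nat.find (hW y) = Nat.find (hW x) := by
      rw [Nat.find_eq_iff]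
      refine ⟨(hy _ (by simp)).2 (Nat.find_spec (hW x)), fun n hn h ↦ ?_⟩
      exact Nat.find_min (hW x) hn ((hy n (Finset.mem_range.2 (hn.trans (Nat.lt_succ_self _)))).1 h)
    simp only [this, hCt hyt]

end Topology

/-! ### Two-forms evaluated on vectors of the model space -/

namespace PadicHamiltonian

section Eval

variable {𝕜 : Type*} [NontriviallyNormedField 𝕜]
  {E : Type*} [NormedAddCommGroup E] [NormedSpace 𝕜 E]
  {M : Type*} [TopologicalSpace M] [ChartedSpace E M]

/-- The value of a `2`-form at a point on two vectors of the model space. -/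
noncomputable def TwoForm.eval (Ω : TwoForm 𝕜 E M) (m : M) (u v : E) : 𝕜 :=
  Ω m ![(u : TangentSpace 𝓘(𝕜, E) m), (v : TangentSpace 𝓘(𝕜, E) m)]

theorem TwoForm.eval_swap (Ω : TwoForm 𝕜 E M) (m : M) (u v : E) :
    Ω.eval m u v = - Ω.eval m v u := by
  have h := (Ω m).map_swap (![v, u] : Fin 2 → E) (i := 0) (j := 1) (by decide)
  have h2 : (![v, u] : Fin 2 → E) ∘ Equiv.swap (0 : Fin 2) 1 = ![u, v] := by
    ext i; fin_cases i <;> simp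
  exact (congrArg (Ω m) h2.symm).trans h

variable (𝕜 E) in
/-- An alternating bilinear form, as a bilinear map. -/
noncomputable def curryTwo : (E [⋀^Fin 2]→L[𝕜] 𝕜) →L[𝕜] E →L[𝕜] E →L[𝕜] 𝕜 :=
  ContinuousLinearMap.compL 𝕜 E (E [⋀^Fin 1]→L[𝕜] 𝕜) (E →L[𝕜] 𝕜)
      (ContinuousAlternatingMap.ofSubsingletonLIE (𝕜 := 𝕜) (E := E) (F := 𝕜)
        (0 : Fin 1)).symm.toContinuousLinearEquiv.toContinuousLinearMap ∘L
    (ContinuousAlternatingMap.curryLeftLI (𝕜 := 𝕜) (E := E) (F := 𝕜)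
      (n := 1)).toContinuousLinearMap

theorem curryTwo_apply (f : E [⋀^Fin 2]→L[𝕜] 𝕜) (u v : E) : curryTwo 𝕜 E f u v = f ![u, v] := by
  change f (Matrix.vecCons u fun _ ↦ v) = _
  congr 1
  ext i; fin_cases i <;> rfl

theorem fderiv_curryTwo_of_extDeriv_eq_zero {w : E → E [⋀^Fin 2]→L[𝕜] 𝕜} {y : E}
    (hw : DifferentiableAt 𝕜 w y) (hd : extDeriv w y = 0) (u v t : E) :
    fderiv 𝕜 (fun y ↦ curryTwo 𝕜 E (w y)) y u v t - fderiv 𝕜 (fun y ↦ curryTwo 𝕜 E (w y)) y v u t +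
      fderiv 𝕜 (fun y ↦ curryTwo 𝕜 E (w y)) y t u v = 0 := by
  have hB : DifferentiableAt 𝕜 (fun y ↦ curryTwo 𝕜 E (w y)) y :=
    DifferentiableAt.comp (g := curryTwo 𝕜 E) y
      (ContinuousLinearMap.differentiableAt (F := E →L[𝕜] E →L[𝕜] 𝕜) _) hw
  have h1 (a b c : E) : fderiv 𝕜 (fun y ↦ curryTwo 𝕜 E (w y)) y a b c =
      fderiv 𝕜 (fun y ↦ w y ![b, c]) y a := by
    have h2 := ((hB.hasFDerivAt.clm_apply (hasFDerivAt_const b y)).clm_apply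
      (hasFDerivAt_const c y)).fderiv
    simp only [curryTwo_apply] at h2
    rw [h2]
    simp
  have h3 := DFunLike.congr_fun hd ![u, v, t]
  rw [extDeriv_apply hw, Fin.sum_univ_three] at h3
  have e0 : (0 : Fin 3).removeNth ![u, v, t] = ![v, t] := by
    ext i; fin_cases i <;> rfl
  have e1 : (1 : Fin 3).removeNth ![u, v, t] = ![u, t] := by
    ext i; fin_cases i <;> rfl
  have e2 : (2 : Fin 3).removeNth ![u, v, t] = ![u, v] := by
    ext i; fin_cases i <;> rfl
  rw [e0, e1, e2] at h3
  simp at h3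
  rw [h1, h1, h1]
  linear_combination h3

variable {E' : Type*} [NormedAddCommGroup E'] [NormedSpace 𝕜 E']
  {N : Type*} [TopologicalSpace N] [ChartedSpace E' N]

theorem TwoForm.eval_pullback (f : N → M) (Ω : TwoForm 𝕜 E M) (x : N) (u v : E') :
    (TwoForm.pullback f Ω).eval x u v =
      Ω.eval (f x) (mfderiv 𝓘(𝕜, E') 𝓘(𝕜, E) f x u) (mfderiv 𝓘(𝕜, E') 𝓘(𝕜, E) f x v) := by
  change Ω (f x) (mfderiv 𝓘(𝕜, E') 𝓘(𝕜, E) f x ∘ ![u, v]) = _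
  unfold TwoForm.eval
  congr 1
  ext i; fin_cases i <;> rfl

theorem IsSymplecticAction.eval_smul {G : Type*} [Group G] [MulAction G M] {Ω : TwoForm 𝕜 E M}
    (h : IsSymplecticAction G Ω) (g : G) (m : M) (u v : E) :
    Ω.eval (g • m) (mfderiv 𝓘(𝕜, E) 𝓘(𝕜, E) (fun m : M ↦ g • m) m u)
      (mfderiv 𝓘(𝕜, E) 𝓘(𝕜, E) (fun m : M ↦ g • m) m v) = Ω.eval m u v := by
  rw [← TwoForm.eval_pullback (fun m : M ↦ g • m), h g]

theorem TwoForm.inChart_apply (Ω : TwoForm 𝕜 E M) (x₀ : M) (y u v : E) :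
    Ω.inChart x₀ y ![u, v] = Ω.eval ((chartAt E x₀).symm y)
      (mfderiv 𝓘(𝕜, E) 𝓘(𝕜, E) (chartAt E x₀).symm y u)
      (mfderiv 𝓘(𝕜, E) 𝓘(𝕜, E) (chartAt E x₀).symm y v) :=
  TwoForm.eval_pullback _ Ω y u v

theorem TwoForm.inChart_chart_apply [IsManifold 𝓘(𝕜, E) ω M] (Ω : TwoForm 𝕜 E M) {x₀ x : M}
    (hx : x ∈ (chartAt E x₀).source) (u v : E) :
    Ω.inChart x₀ (chartAt E x₀ x) ![mfderiv 𝓘(𝕜, E) 𝓘(𝕜, E) (chartAt E x₀) x u,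
      mfderiv 𝓘(𝕜, E) 𝓘(𝕜, E) (chartAt E x₀) x v] = Ω.eval x u v := by
  have : IsManifold 𝓘(𝕜, E) 1 M := .of_le le_top
  have h1 (u : E) : mfderiv 𝓘(𝕜, E) 𝓘(𝕜, E) (chartAt E x₀).symm (chartAt E x₀ x)
      (mfderiv 𝓘(𝕜, E) 𝓘(𝕜, E) (chartAt E x₀) x u) = u :=
    DFunLike.congr_fun ((mdifferentiable_chart (I := 𝓘(𝕜, E)) x₀).symm_comp_deriv hx) u
  refine (Ω.inChart_apply x₀ _ _ _).trans ?_
  have h2 := (chartAt E x₀).left_inv hx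
  rw [h1, h1, h2]

end Eval

/-! ### Generators, tangent spaces of orbits, and the easy direction -/

section Action

variable {𝕜 : Type*} [NontriviallyNormedField 𝕜]
  {F : Type*} [NormedAddCommGroup F] [NormedSpace 𝕜 F]
  {E : Type*} [NormedAddCommGroup E] [NormedSpace 𝕜 E]
  {G : Type*} [CommGroup G] [TopologicalSpace G] [ChartedSpace F G]
  {M : Type*} [TopologicalSpace M] [ChartedSpace E M] [MulAction G M]

variable (𝕜 F E M) in
theorem contMDiff_smul_left [ContMDiffSMul 𝓘(𝕜, F) 𝓘(𝕜, E) ω G M] (g : G) :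
    ContMDiff 𝓘(𝕜, E) 𝓘(𝕜, E) ω (fun m : M ↦ g • m) :=
  (contMDiff_const (I := 𝓘(𝕜, E)) (I' := 𝓘(𝕜, F))).smul contMDiff_id

variable (𝕜 F E M) in
theorem mdifferentiable_smul_left [ContMDiffSMul 𝓘(𝕜, F) 𝓘(𝕜, E) ω G M] (g : G) :
    MDifferentiable 𝓘(𝕜, E) 𝓘(𝕜, E) (fun m : M ↦ g • m) :=
  (contMDiff_smul_left 𝕜 F E M g).mdifferentiable (by simp)

theorem coAd_eq_self (g : G) (α : F →L[𝕜] 𝕜) : coAd 𝕜 F g α = α := by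
  have h : (fun h : G ↦ g⁻¹ * h * g⁻¹⁻¹) = id := by
    ext h; simp [mul_comm]
  ext v
  unfold coAd Ad
  rw [h]
  change α (mfderiv 𝓘(𝕜, F) 𝓘(𝕜, F) (id : G → G) 1 v) = α v
  rw [mfderiv_id]
  rfl

variable [ContMDiffSMul 𝓘(𝕜, F) 𝓘(𝕜, E) ω G M]

variable (𝕜 F E G) in
theorem contMDiff_orbitMap (m : M) : ContMDiff 𝓘(𝕜, F) 𝓘(𝕜, E) ω (fun g : G ↦ g • m) :=
  (contMDiff_id (I := 𝓘(𝕜, F)) (M := G)).smul contMDiff_const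

variable (𝕜 F E G) in
theorem mdifferentiable_orbitMap (m : M) : MDifferentiable 𝓘(𝕜, F) 𝓘(𝕜, E) (fun g : G ↦ g • m) :=
  (contMDiff_orbitMap 𝕜 F E G m).mdifferentiable (by simp)

/-- The generators of an action of an Abelian group are invariant. -/
theorem mfderiv_smul_infinitesimalGenerator (g : G) (m : M) (ξ : GroupLieAlgebra 𝓘(𝕜, F) G) :
    (mfderiv 𝓘(𝕜, E) 𝓘(𝕜, E) (fun m : M ↦ g • m) m (infinitesimalGenerator E ξ m) : E) =
      infinitesimalGenerator E ξ (g • m) := by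
  have h : (fun h : G ↦ h • g • m) = (fun m : M ↦ g • m) ∘ fun h : G ↦ h • m := by
    ext h; exact smul_comm h g m
  have h1 := mfderiv_comp_of_eq (y := m) (I' := 𝓘(𝕜, E)) (mdifferentiable_smul_left 𝕜 F E M g m)
    (mdifferentiable_orbitMap 𝕜 F E G m 1) (one_smul G m)
  rw [← h] at h1
  have h2 : (infinitesimalGenerator E ξ (g • m) : E) =
      (mfderiv 𝓘(𝕜, E) 𝓘(𝕜, E) (fun m : M ↦ g • m) ((1 : G) • m) : E →L[𝕜] E)
        (infinitesimalGenerator E ξ m : E) := DFunLike.congr_fun h1 ξ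
  rw [one_smul] at h2
  exact h2.symm

/-- The tangent vectors to the orbits are values of generators. -/
theorem orbitMapDeriv_apply [LieGroup 𝓘(𝕜, F) ω G] (m : M) (g : G) (v : F) :
    (orbitMapDeriv 𝕜 F E m g v : E) = infinitesimalGenerator (G := G) E
      (mfderiv 𝓘(𝕜, F) 𝓘(𝕜, F) (fun h : G ↦ h * g⁻¹) g v : F) (g • m) := by
  have h : (fun h : G ↦ h • m) = (fun h : G ↦ h • g • m) ∘ fun h : G ↦ h * g⁻¹ := by
    ext h; simp [← mul_smul]
  have h1 := mfderiv_comp_of_eq (y := 1) (I' := 𝓘(𝕜, F))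
    (mdifferentiable_orbitMap 𝕜 F E G (g • m) 1)
    (((contMDiff_mul_right (I := 𝓘(𝕜, F)) (n := ω)).mdifferentiable (by simp)) g)
    (mul_inv_cancel g)
  rw [← h] at h1
  have h2 : (orbitMapDeriv 𝕜 F E m g v : E) =
      (mfderiv 𝓘(𝕜, F) 𝓘(𝕜, E) (fun h : G ↦ h • g • m) (g * g⁻¹) : F →L[𝕜] E)
        (mfderiv 𝓘(𝕜, F) 𝓘(𝕜, F) (fun h : G ↦ h * g⁻¹) g v : F) := DFunLike.congr_fun h1 v
  rw [mul_inv_cancel] at h2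
  exact h2

/-- Right translation carries tangent vectors at `g` to the identity, so every tangent vector to the
orbit at `g • m` is the value there of a generator; conversely, `g = 1` recovers all generators. -/
theorem isIsotropicOrbit_iff [LieGroup 𝓘(𝕜, F) ω G] {Ω : TwoForm 𝕜 E M} :
    (∀ m : M, IsIsotropicOrbit 𝕜 F G Ω m) ↔
      ∀ (ξ η : GroupLieAlgebra 𝓘(𝕜, F) G) (m : M),
        Ω m ![infinitesimalGenerator E ξ m, infinitesimalGenerator E η m] = 0 := by
  constructor
  · intro h ξ η m
    have h1 := h m 1 _ ⟨ξ, rfl⟩ _ ⟨η, rfl⟩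
    change Ω.eval ((1 : G) • m) (infinitesimalGenerator E ξ m)
      (infinitesimalGenerator E η m) = 0 at h1
    rwa [one_smul] at h1
  · rintro h m g _ ⟨u, rfl⟩ _ ⟨v, rfl⟩
    have h1 := h (mfderiv 𝓘(𝕜, F) 𝓘(𝕜, F) (fun h : G ↦ h * g⁻¹) g u : F)
      (mfderiv 𝓘(𝕜, F) 𝓘(𝕜, F) (fun h : G ↦ h * g⁻¹) g v : F) (g • m)
    exact (congrArg₂ (Ω.eval (g • m)) (orbitMapDeriv_apply (F := F) m g u)
      (orbitMapDeriv_apply (F := F) m g v)).trans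
      h1

theorem IsHamiltonian.eval_infinitesimalGenerator {Ω : TwoForm 𝕜 E M} (h : IsHamiltonian F G Ω)
    (ξ η : GroupLieAlgebra 𝓘(𝕜, F) G) (m : M) :
    Ω m ![infinitesimalGenerator E ξ m, infinitesimalGenerator E η m] = 0 := by
  obtain ⟨μ, hμ, hinv⟩ := h
  rw [hμ.hamilton]
  have h1 : (fun x : M ↦ μ x ξ) ∘ (fun g : G ↦ g • m) = fun _ ↦ μ m ξ := by
    ext g
    simp only [Function.comp, hinv, coAd_eq_self]
  have hd : MDifferentiableAt 𝓘(𝕜, E) 𝓘(𝕜, 𝕜) (fun x : M ↦ μ x ξ) m :=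
    ((hμ.analytic m).mdifferentiableAt (by simp)).clm_apply mdifferentiableAt_const
  have h2 := mfderiv_comp_of_eq (y := m) (I' := 𝓘(𝕜, E)) hd
    (mdifferentiable_orbitMap 𝕜 F E G m 1) (one_smul G m)
  rw [h1] at h2
  have h3 := DFunLike.congr_fun h2 η
  rw [mfderiv_const] at h3
  have h4 : (mfderiv 𝓘(𝕜, E) 𝓘(𝕜, 𝕜) (fun x : M ↦ μ x ξ) ((1 : G) • m) : E →L[𝕜] 𝕜)
      (infinitesimalGenerator E η m : E) = 0 := h3.symm
  rw [one_smul] at h4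
  exact h4

end Action

end PadicHamiltonian

/-! ### The action in charts -/

namespace PadicHamiltonian

section LocalPrimitive

variable {𝕜 : Type*} [NontriviallyNormedField 𝕜]
  {F : Type*} [NormedAddCommGroup F] [NormedSpace 𝕜 F]
  {E : Type*} [NormedAddCommGroup E] [NormedSpace 𝕜 E]
  {G : Type*} [CommGroup G] [TopologicalSpace G] [ChartedSpace F G]
  {M : Type*} [TopologicalSpace M] [ChartedSpace E M] [MulAction G M]

variable (F G) in
/-- The action in the charts at `1` and at `x₀`. -/
noncomputable def actionInChart (x₀ : M) (z : F × E) : E :=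
  chartAt E x₀ (((chartAt F (1 : G)).symm z.1) • ((chartAt E x₀).symm z.2))

variable (F G) in
/-- The domain of `actionInChart`. -/
def actionInChartDomain (x₀ : M) : Set (F × E) :=
  {z | z.1 ∈ (chartAt F (1 : G)).target ∧ z.2 ∈ (chartAt E x₀).target ∧
    ((chartAt F (1 : G)).symm z.1) • ((chartAt E x₀).symm z.2) ∈ (chartAt E x₀).source}

theorem actionInChartDomain_mem_nhds [ContinuousSMul G M] (x₀ : M) {z : F × E} (hz : z ∈ actionInChartDomain F G x₀) :
    actionInChartDomain F G x₀ ∈ 𝓝 z := by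
  obtain ⟨h1, h2, h3⟩ := hz
  have hφ : ContinuousAt (fun z : F × E ↦ (chartAt F (1 : G)).symm z.1) z :=
    ((chartAt F (1 : G)).continuousAt_symm h1).comp continuousAt_fst
  have hχ : ContinuousAt (fun z : F × E ↦ (chartAt E x₀).symm z.2) z :=
    ((chartAt E x₀).continuousAt_symm h2).comp continuousAt_snd
  filter_upwards [continuousAt_fst ((chartAt F (1 : G)).open_target.mem_nhds h1),
    continuousAt_snd ((chartAt E x₀).open_target.mem_nhds h2),
    (hφ.smul hχ) ((chartAt E x₀).open_source.mem_nhds h3)] with z h1 h2 h3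
  exact ⟨h1, h2, h3⟩

theorem one_mem_actionInChartDomain {x₀ : M} {y : E} (hy : y ∈ (chartAt E x₀).target) :
    (chartAt F (1 : G) 1, y) ∈ actionInChartDomain F G x₀ := by
  refine ⟨mem_chart_target F 1, hy, ?_⟩
  simpa using (chartAt E x₀).map_target hy

theorem actionInChart_one {x₀ : M} {y : E} (hy : y ∈ (chartAt E x₀).target) :
    actionInChart F G x₀ (chartAt F (1 : G) 1, y) = y := by
  simp [actionInChart, (chartAt E x₀).right_inv hy]

variable [LieGroup 𝓘(𝕜, F) ω G] [IsManifold 𝓘(𝕜, E) ω M] [ContMDiffSMul 𝓘(𝕜, F) 𝓘(𝕜, E) ω G M]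

theorem contDiffAt_actionInChart {x₀ : M} {z : F × E} (hz : z ∈ actionInChartDomain F G x₀) :
    ContDiffAt 𝕜 ω (actionInChart F G x₀) z := by
  obtain ⟨h1, h2, h3⟩ := hz
  have hφ : ContMDiffAt 𝓘(𝕜, F × E) 𝓘(𝕜, F) ω
      (fun z : F × E ↦ (chartAt F (1 : G)).symm z.1) z :=
    ((contMDiffOn_chart_symm (I := 𝓘(𝕜, F)) (x := (1 : G)) (n := ω)).contMDiffAt
      ((chartAt F (1 : G)).open_target.mem_nhds h1)).comp z contDiffAt_fst.contMDiffAt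
  have hχ : ContMDiffAt 𝓘(𝕜, F × E) 𝓘(𝕜, E) ω (fun z : F × E ↦ (chartAt E x₀).symm z.2) z :=
    ((contMDiffOn_chart_symm (I := 𝓘(𝕜, E)) (x := x₀) (n := ω)).contMDiffAt
      ((chartAt E x₀).open_target.mem_nhds h2)).comp z contDiffAt_snd.contMDiffAt
  have hc : ContMDiffAt 𝓘(𝕜, E) 𝓘(𝕜, E) ω (chartAt E x₀)
      (((chartAt F (1 : G)).symm z.1) • ((chartAt E x₀).symm z.2)) :=
    (contMDiffOn_chart (I := 𝓘(𝕜, E)) (x := x₀) (n := ω)).contMDiffAt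
      ((chartAt E x₀).open_source.mem_nhds h3)
  exact (hc.comp z (hφ.smul hχ)).contDiffAt

theorem fderiv_actionInChart_inr {x₀ : M} {z : F × E} (hz : z ∈ actionInChartDomain F G x₀)
    (u : E) : fderiv 𝕜 (actionInChart F G x₀) z (0, u) =
      mfderiv 𝓘(𝕜, E) 𝓘(𝕜, E) (chartAt E x₀)
        (((chartAt F (1 : G)).symm z.1) • ((chartAt E x₀).symm z.2))
        (mfderiv 𝓘(𝕜, E) 𝓘(𝕜, E) (fun m : M ↦ ((chartAt F (1 : G)).symm z.1) • m)
          ((chartAt E x₀).symm z.2) (mfderiv 𝓘(𝕜, E) 𝓘(𝕜, E) (chartAt E x₀).symm z.2 u)) := by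
  have hd := (contDiffAt_actionInChart (𝕜 := 𝕜) hz).differentiableAt (by simp)
  obtain ⟨h1, h2, h3⟩ := hz
  have : IsManifold 𝓘(𝕜, E) 1 M := .of_le le_top
  have hM := mdifferentiable_chart (I := 𝓘(𝕜, E)) x₀
  have hi : HasFDerivAt (fun y : E ↦ (z.1, y)) (ContinuousLinearMap.inr 𝕜 F E) z.2 :=
    hasFDerivAt_prodMk_right z.1 z.2
  have h4 := (hd.hasFDerivAt.comp z.2 hi).hasMFDerivAt
  have h5 := (hM.mdifferentiableAt h3).hasMFDerivAt.comp z.2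
    ((mdifferentiable_smul_left 𝕜 F E M _ _).hasMFDerivAt.comp z.2
      (hM.mdifferentiableAt_symm h2).hasMFDerivAt)
  exact DFunLike.congr_fun (hasMFDerivAt_unique h4 h5) u

theorem fderiv_actionInChart_inl {x₀ x : M} (hx : x ∈ (chartAt E x₀).source) (ξ : F) :
    fderiv 𝕜 (actionInChart F G x₀) (chartAt F (1 : G) 1, chartAt E x₀ x) (ξ, 0) =
      mfderiv 𝓘(𝕜, E) 𝓘(𝕜, E) (chartAt E x₀) x (infinitesimalGenerator (G := G) E ξ x) := by
  have hy := (chartAt E x₀).map_source hx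
  have hz := one_mem_actionInChartDomain (F := F) (G := G) hy
  have hd := (contDiffAt_actionInChart (𝕜 := 𝕜) hz).differentiableAt (by simp)
  have : IsManifold 𝓘(𝕜, E) 1 M := .of_le le_top
  have : IsManifold 𝓘(𝕜, F) 1 G := .of_le (n := ω) le_top
  have hM := mdifferentiable_chart (I := 𝓘(𝕜, E)) x₀
  have hN := mdifferentiable_chart (I := 𝓘(𝕜, F)) (1 : G)
  have hi : HasFDerivAt (fun s : F ↦ (s, chartAt E x₀ x)) (ContinuousLinearMap.inl 𝕜 F E)
      (chartAt F (1 : G) 1) := hasFDerivAt_prodMk_left _ _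
  have h4 := (HasFDerivAt.comp (f := fun s : F ↦ (s, chartAt E x₀ x)) (chartAt F (1 : G) 1)
    hd.hasFDerivAt hi).hasMFDerivAt
  have h1 : (chartAt F (1 : G)).symm (chartAt F (1 : G) 1) = 1 :=
    (chartAt F (1 : G)).left_inv (mem_chart_source F 1)
  -- The tangent space at `1` is identified with `F` through the preferred chart at `1`, so this
  -- chart contributes no change of coordinates to `ξ`.
  have h2 : (mfderiv 𝓘(𝕜, F) 𝓘(𝕜, F) (chartAt F (1 : G)).symm (chartAt F (1 : G) 1) : F →L[𝕜] F) =
      ContinuousLinearMap.id 𝕜 F := by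
    have := mfderivWithin_range_extChartAt_symm (I := 𝓘(𝕜, F)) (x := (1 : G))
    simpa [mfderivWithin_univ] using! this
  have h3 := (chartAt E x₀).left_inv hx
  have h5 := (hM.mdifferentiableAt (x := (chartAt F (1 : G)).symm (chartAt F (1 : G) 1) •
      (chartAt E x₀).symm (chartAt E x₀ x)) (by rwa [h1, h3, one_smul])).hasMFDerivAt.comp
    (chartAt F (1 : G) 1)
    ((mdifferentiable_orbitMap 𝕜 F E G ((chartAt E x₀).symm (chartAt E x₀ x)) _).hasMFDerivAt.comp
      (chartAt F (1 : G) 1) (hN.mdifferentiableAt_symm (mem_chart_target F 1)).hasMFDerivAt)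
  have h6 : fderiv 𝕜 (actionInChart F G x₀) (chartAt F (1 : G) 1, chartAt E x₀ x) (ξ, 0) =
      (mfderiv 𝓘(𝕜, E) 𝓘(𝕜, E) (chartAt E x₀) ((chartAt F (1 : G)).symm (chartAt F (1 : G) 1) •
        (chartAt E x₀).symm (chartAt E x₀ x)) : E →L[𝕜] E)
      ((mfderiv 𝓘(𝕜, F) 𝓘(𝕜, E) (fun g : G ↦ g • (chartAt E x₀).symm (chartAt E x₀ x))
        ((chartAt F (1 : G)).symm (chartAt F (1 : G) 1)) : F →L[𝕜] E)
      ((mfderiv 𝓘(𝕜, F) 𝓘(𝕜, F) (chartAt F (1 : G)).symm (chartAt F (1 : G) 1) : F →L[𝕜] F) ξ)) :=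
    DFunLike.congr_fun (hasMFDerivAt_unique h4 h5) ξ
  rw [h2, h1, h3, one_smul] at h6
  exact h6

/-- The form of an invariant `2`-form in a chart is invariant under the action in the chart. -/
theorem IsSymplecticAction.inChart_actionInChart {Ω : TwoForm 𝕜 E M} (h : IsSymplecticAction G Ω)
    {x₀ : M} {z : F × E} (hz : z ∈ actionInChartDomain F G x₀) (u v : E) :
    Ω.inChart x₀ (actionInChart F G x₀ z) ![fderiv 𝕜 (actionInChart F G x₀) z (0, u),
      fderiv 𝕜 (actionInChart F G x₀) z (0, v)] = Ω.inChart x₀ z.2 ![u, v] := by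
  rw [fderiv_actionInChart_inr hz, fderiv_actionInChart_inr hz, TwoForm.inChart_apply]
  exact (Ω.inChart_chart_apply hz.2.2 _ _).trans (h.eval_smul _ _ _ _)

end LocalPrimitive

/-! ### Local solutions of Hamilton's equation -/

section Padic

variable {p : ℕ} [Fact p.Prime]
  {F : Type*} [NormedAddCommGroup F] [NormedSpace ℚ_[p] F]
  {E : Type*} [NormedAddCommGroup E] [NormedSpace ℚ_[p] E] [CompleteSpace E]
  {G : Type*} [CommGroup G] [TopologicalSpace G] [ChartedSpace F G] [LieGroup 𝓘(ℚ_[p], F) ω G]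
  {M : Type*} [TopologicalSpace M] [ChartedSpace E M] [IsManifold 𝓘(ℚ_[p], E) ω M] [MulAction G M]
  [ContMDiffSMul 𝓘(ℚ_[p], F) 𝓘(ℚ_[p], E) ω G M]

variable (F) in
/-- `ν` is analytic at `x` and satisfies Hamilton's equation there. -/
def IsMomentumMapAt (G : Type*) [Group G] [TopologicalSpace G] [ChartedSpace F G] [MulAction G M]
    (Ω : TwoForm ℚ_[p] E M) (ν : M → F →L[ℚ_[p]] ℚ_[p]) (x : M) : Prop :=
  ContMDiffAt 𝓘(ℚ_[p], E) 𝓘(ℚ_[p], F →L[ℚ_[p]] ℚ_[p]) ω ν x ∧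
    ∃ L : E →L[ℚ_[p]] F →L[ℚ_[p]] ℚ_[p],
      HasMFDerivAt 𝓘(ℚ_[p], E) 𝓘(ℚ_[p], F →L[ℚ_[p]] ℚ_[p]) ν x L ∧
      ∀ (v : E) (ξ : F), L v ξ = Ω.eval x (infinitesimalGenerator (𝕜 := ℚ_[p]) (F := F) (G := G) E ξ x) v

/-- The contraction takes values in the dual of `F`, so a single application of the Poincaré lemma
in the chart treats all `ξ` at once. Orthogonality of the generators plays no role here. -/
theorem IsSymplecticForm.exists_eventually_isMomentumMapAt {Ω : TwoForm ℚ_[p] E M}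
    (hΩ : IsSymplecticForm Ω) (hG : IsSymplecticAction G Ω) (x₀ : M) :
    ∃ ν : M → F →L[ℚ_[p]] ℚ_[p], ∀ᶠ x in 𝓝 x₀, IsMomentumMapAt F G Ω ν x := by
  have : ContinuousSMul G M :=
    ContMDiffSMul.continuousSMul (I := 𝓘(ℚ_[p], F)) (I' := 𝓘(ℚ_[p], E)) ω
  set χ := chartAt E x₀ with hχ
  have hy₀ : χ x₀ ∈ χ.target := mem_chart_target E x₀
  set A := actionInChart (E := E) F G x₀ with hAdef
  set w : E → E →L[ℚ_[p]] E →L[ℚ_[p]] ℚ_[p] := fun y ↦ curryTwo ℚ_[p] E (Ω.inChart x₀ y) with hwdef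
  have hz₀ := one_mem_actionInChartDomain (F := F) (G := G) hy₀
  have hA : AnalyticAt ℚ_[p] A (chartAt F (1 : G) 1, χ x₀) :=
    (contDiffAt_actionInChart hz₀).analyticAt
  have hw : AnalyticAt ℚ_[p] w (χ x₀) :=
    AnalyticAt.comp (g := curryTwo ℚ_[p] E)
      (ContinuousLinearMap.analyticAt (F := E →L[ℚ_[p]] E →L[ℚ_[p]] ℚ_[p]) _ _) (hΩ.analytic x₀ _ hy₀)
  have htarget : ∀ᶠ y in 𝓝 (χ x₀), y ∈ χ.target := χ.open_target.mem_nhds hy₀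
  have hcl := fderiv_contractGenerator_symm (s := chartAt F (1 : G) 1) hw hA
    (htarget.mono fun y hy ↦ actionInChart_one hy)
    (by
      filter_upwards [actionInChartDomain_mem_nhds x₀ hz₀] with z hz u v
      simp only [hwdef, curryTwo_apply]
      exact hG.inChart_actionInChart hz u v)
    (fun y u v ↦ by
      simp only [hwdef, curryTwo_apply, TwoForm.inChart_apply]
      exact TwoForm.eval_swap _ _ _ _)
    (htarget.mono fun y hy ↦ fderiv_curryTwo_of_extDeriv_eq_zero
      (hΩ.analytic x₀ _ hy).differentiableAt (hΩ.closed x₀ y hy))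
  obtain ⟨f, hf, hfα⟩ := (analyticAt_contractGenerator hw hA).exists_primitive hcl
  refine ⟨f ∘ χ, ?_⟩
  have hcont : Filter.Tendsto χ (𝓝 x₀) (𝓝 (χ x₀)) := χ.continuousAt (mem_chart_source E x₀)
  filter_upwards [hcont.eventually hf.eventually_analyticAt, hcont.eventually hfα,
    χ.open_source.mem_nhds (mem_chart_source E x₀)] with x hfx hfαx hx
  have hχx : ContMDiffAt 𝓘(ℚ_[p], E) 𝓘(ℚ_[p], E) ω χ x :=
    (contMDiffOn_chart (I := 𝓘(ℚ_[p], E)) (x := x₀) (n := ω)).contMDiffAt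
      (χ.open_source.mem_nhds hx)
  refine ⟨hfx.contDiffAt.contMDiffAt.comp x hχx, _,
    hfx.differentiableAt.hasFDerivAt.hasMFDerivAt.comp x
      (hχx.mdifferentiableAt (by simp)).hasMFDerivAt, fun v ξ ↦ ?_⟩
  change fderiv ℚ_[p] f (χ x) (mfderiv 𝓘(ℚ_[p], E) 𝓘(ℚ_[p], E) χ x v) ξ = _
  rw [hfαx]
  exact ((congrArg (fun X ↦ w (χ x) X (mfderiv 𝓘(ℚ_[p], E) 𝓘(ℚ_[p], E) χ x v))
    (fderiv_actionInChart_inl hx ξ)).trans (curryTwo_apply _ _ _)).trans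
    (Ω.inChart_chart_apply hx _ v)

end Padic

end PadicHamiltonian

/-! ### Local constancy and compact open neighbourhoods on manifolds -/

/-- A `p`-adic analytic map on a manifold with vanishing derivative is locally constant. -/
theorem ContMDiffAt.eventually_eq_of_hasMFDerivAt_zero {p : ℕ} [Fact p.Prime]
    {E : Type*} [NormedAddCommGroup E] [NormedSpace ℚ_[p] E]
    {H : Type*} [TopologicalSpace H] {I : ModelWithCorners ℚ_[p] E H} [I.Boundaryless]
    {N : Type*} [TopologicalSpace N] [ChartedSpace H N] [IsManifold I 1 N]
    {V : Type*} [NormedAddCommGroup V] [NormedSpace ℚ_[p] V] [CompleteSpace V]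
    {f : N → V} {x : N} (hf : ContMDiffAt I 𝓘(ℚ_[p], V) ω f x)
    (h : ∀ᶠ y in 𝓝 x, HasMFDerivAt I 𝓘(ℚ_[p], V) f y (0 : E →L[ℚ_[p]] V)) :
    ∀ᶠ y in 𝓝 x, f y = f x := by
  have h1 : ContDiffAt ℚ_[p] ω (f ∘ (extChartAt I x).symm) (extChartAt I x x) := by
    have h0 := (contMDiffAt_iff.1 hf).2
    rw [I.range_eq_univ, contDiffWithinAt_univ] at h0
    exact h0
  have h2 : Filter.Tendsto (extChartAt I x).symm (𝓝 (extChartAt I x x)) (𝓝 x) := by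
    simpa using (continuousAt_extChartAt_symm (I := I) x).tendsto
  have h3 : ∀ᶠ z in 𝓝 (extChartAt I x x), fderiv ℚ_[p] (f ∘ (extChartAt I x).symm) z = 0 := by
    filter_upwards [h2.eventually h, extChartAt_target_mem_nhds x] with z hz hzt
    have h4 := hz.comp_hasMFDerivWithinAt z
      (mdifferentiableWithinAt_extChartAt_symm (I := I) hzt).hasMFDerivWithinAt
    rw [I.range_eq_univ, hasMFDerivWithinAt_univ] at h4
    have h5 : HasFDerivAt (f ∘ (extChartAt I x).symm) (0 : E →L[ℚ_[p]] V) z :=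
      hasMFDerivAt_iff_hasFDerivAt.1 (h4.congr_mfderiv (ContinuousLinearMap.zero_comp _))
    exact h5.fderiv
  filter_upwards [(continuousAt_extChartAt (I := I) x).eventually
    (h1.analyticAt.eventually_eq_of_fderiv_eq_zero h3), extChartAt_source_mem_nhds (I := I) x]
    with y hy hys
  rwa [Function.comp_apply, Function.comp_apply, (extChartAt I x).left_inv hys,
    extChartAt_to_inv] at hy

/-- Closed balls of positive radius in a proper ultrametric space are both compact and open; a small
one is transported by the chart. -/
theorem ChartedSpace.exists_isCompact_isOpen_subset {E : Type*} [PseudoMetricSpace E]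
    [ProperSpace E] [IsUltrametricDist E] {M : Type*} [TopologicalSpace M] [ChartedSpace E M]
    {x : M} {U : Set M} (hU : U ∈ 𝓝 x) : ∃ V ⊆ U, IsCompact V ∧ IsOpen V ∧ x ∈ V := by
  set χ := chartAt E x
  have hx : x ∈ χ.source := mem_chart_source E x
  have h1 : χ.target ∩ χ.symm ⁻¹' U ∈ 𝓝 (χ x) :=
    Filter.inter_mem (χ.open_target.mem_nhds (χ.map_source hx))
      ((χ.continuousAt_symm (χ.map_source hx)) (by rwa [χ.left_inv hx]))
  obtain ⟨r, hr, hrs⟩ := Metric.nhds_basis_closedBall.mem_iff.1 h1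
  refine ⟨χ.symm '' Metric.closedBall (χ x) r, ?_, ?_, ?_, ?_⟩
  · rintro _ ⟨y, hy, rfl⟩
    exact (hrs hy).2
  · exact (isCompact_closedBall _ _).image_of_continuousOn
      (χ.continuousOn_symm.mono fun y hy ↦ (hrs hy).1)
  · exact χ.symm.isOpen_image_of_subset_source (IsUltrametricDist.isOpen_closedBall _ hr.ne')
      fun y hy ↦ (hrs hy).1
  · exact ⟨χ x, Metric.mem_closedBall_self hr.le, χ.left_inv hx⟩

theorem ChartedSpace.firstCountableTopology (E : Type*) [TopologicalSpace E]
    [FirstCountableTopology E] (M : Type*) [TopologicalSpace M] [ChartedSpace E M] :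
    FirstCountableTopology M := by
  refine ⟨fun x ↦ ?_⟩
  rw [← (chartAt E x).symm_map_nhds_eq (mem_chart_source E x)]
  infer_instance

/-! ### Invariant local solutions and gluing -/

namespace PadicHamiltonian

theorem TwoForm.eval_add_right {𝕜 : Type*} [NontriviallyNormedField 𝕜]
    {E : Type*} [NormedAddCommGroup E] [NormedSpace 𝕜 E]
    {M : Type*} [TopologicalSpace M] [ChartedSpace E M] (Ω : TwoForm 𝕜 E M) (m : M) (u v w : E) :
    Ω.eval m u (v + w) = Ω.eval m u v + Ω.eval m u w := by
  have h (f : E [⋀^Fin 2]→L[𝕜] 𝕜) : f ![u, v + w] = f ![u, v] + f ![u, w] := by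
    simp only [← curryTwo_apply, map_add]
  exact h (Ω m)

variable {p : ℕ} [Fact p.Prime]
  {F : Type*} [NormedAddCommGroup F] [NormedSpace ℚ_[p] F]
  {E : Type*} [NormedAddCommGroup E] [NormedSpace ℚ_[p] E]
  {G : Type*} [CommGroup G] [TopologicalSpace G] [ChartedSpace F G]
  {M : Type*} [TopologicalSpace M] [ChartedSpace E M] [MulAction G M]

theorem IsMomentumMapAt.congr {Ω : TwoForm ℚ_[p] E M} {ν ν' : M → F →L[ℚ_[p]] ℚ_[p]} {x : M}
    (h : IsMomentumMapAt F G Ω ν x) (hν : ν' =ᶠ[𝓝 x] ν) : IsMomentumMapAt F G Ω ν' x := by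
  obtain ⟨h1, L, hL, h2⟩ := h
  exact ⟨h1.congr_of_eventuallyEq hν, L, hL.congr_of_eventuallyEq hν, h2⟩

theorem isMomentumMap_of_forall_isMomentumMapAt {Ω : TwoForm ℚ_[p] E M}
    {μ : M → F →L[ℚ_[p]] ℚ_[p]} (h : ∀ x, IsMomentumMapAt F G Ω μ x) : IsMomentumMap G Ω μ := by
  refine ⟨fun x ↦ (h x).1, fun ξ m v ↦ ?_⟩
  obtain ⟨-, L, hL, h2⟩ := h m
  have h3 := ((ContinuousLinearMap.apply (E := F) ℚ_[p] ℚ_[p] ξ).hasFDerivAt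
    (x := μ m)).hasMFDerivAt.comp m hL
  have h4 := DFunLike.congr_fun h3.mfderiv v
  exact (h2 v ξ).symm.trans h4.symm

variable [ContMDiffSMul 𝓘(ℚ_[p], F) 𝓘(ℚ_[p], E) ω G M]

/-- Translation by `g` preserves both `Ω` and, `G` being Abelian, the generators, hence also
Hamilton's equation. -/
theorem IsMomentumMapAt.comp_smul {Ω : TwoForm ℚ_[p] E M} (hG : IsSymplecticAction G Ω)
    {ν : M → F →L[ℚ_[p]] ℚ_[p]} {g : G} {x : M} (h : IsMomentumMapAt F G Ω ν (g • x)) :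
    IsMomentumMapAt F G Ω (fun y ↦ ν (g • y)) x := by
  obtain ⟨h1, L, hL, h2⟩ := h
  refine ⟨h1.comp x (contMDiff_smul_left ℚ_[p] F E M g x), _,
    hL.comp x (mdifferentiable_smul_left ℚ_[p] F E M g x).hasMFDerivAt, fun v ξ ↦ ?_⟩
  refine (h2 _ _).trans ?_
  refine (congrArg (Ω.eval (g • x) · _)
    (mfderiv_smul_infinitesimalGenerator (F := F) g x ξ).symm).trans ?_
  exact hG.eval_smul _ _ _ _

variable [LieGroup 𝓘(ℚ_[p], F) ω G] [IsManifold 𝓘(ℚ_[p], E) ω M]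

/-- If the generators are mutually orthogonal, a local solution of Hamilton's equation is invariant
near the stabilizer of a point. -/
theorem eventually_smul_eq_of_isMomentumMapAt {Ω : TwoForm ℚ_[p] E M}
    (hG : IsSymplecticAction G Ω)
    (hX : ∀ (ξ η : GroupLieAlgebra 𝓘(ℚ_[p], F) G) (m : M),
      Ω m ![infinitesimalGenerator E ξ m, infinitesimalGenerator E η m] = 0)
    {ν : M → F →L[ℚ_[p]] ℚ_[p]} {x₀ : M} (hν : ∀ᶠ x in 𝓝 x₀, IsMomentumMapAt F G Ω ν x)
    {h : G} (hh : h • x₀ = x₀) : ∀ᶠ q in 𝓝 (h, x₀), ν (q.1 • q.2) = ν q.2 := by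
  have : ContinuousSMul G M :=
    ContMDiffSMul.continuousSMul (I := 𝓘(ℚ_[p], F)) (I' := 𝓘(ℚ_[p], E)) ω
  have hS : ContMDiff (𝓘(ℚ_[p], F).prod 𝓘(ℚ_[p], E)) 𝓘(ℚ_[p], E) ω (fun q : G × M ↦ q.1 • q.2) :=
    contMDiff_smul
  have hT : Filter.Tendsto (fun q : G × M ↦ q.1 • q.2) (𝓝 (h, x₀)) (𝓝 x₀) := by
    have := (continuous_smul (M := G) (X := M)).tendsto (h, x₀)
    rwa [hh] at this
  have hf : ContMDiffAt (𝓘(ℚ_[p], F).prod 𝓘(ℚ_[p], E)) 𝓘(ℚ_[p], F →L[ℚ_[p]] ℚ_[p]) ω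
      (fun q : G × M ↦ ν (q.1 • q.2) - ν q.2) (h, x₀) := by
    refine ContMDiffAt.sub ?_ ?_
    · exact ContMDiffAt.comp_of_eq (g := ν) hν.self_of_nhds.1 (hS _) hh
    · exact ContMDiffAt.comp_of_eq (g := ν) hν.self_of_nhds.1 contMDiffAt_snd rfl
  have : IsManifold 𝓘(ℚ_[p], E) 1 M := .of_le (n := ω) le_top
  have : IsManifold 𝓘(ℚ_[p], F) 1 G := .of_le (n := ω) le_top
  have hz := hf.eventually_eq_of_hasMFDerivAt_zero ?_
  · filter_upwards [hz] with q hq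
    simpa [hh, sub_eq_zero] using hq
  filter_upwards [hT.eventually hν, continuousAt_snd.eventually hν] with q h1 h2
  obtain ⟨-, L1, hL1, h1⟩ := h1
  obtain ⟨-, L2, hL2, h2⟩ := h2
  have hSq := ((hS q).mdifferentiableAt (by simp)).hasMFDerivAt
  have hd := (hL1.comp q hSq).sub (hL2.comp q (hasMFDerivAt_snd (I := 𝓘(ℚ_[p], F))
    (I' := 𝓘(ℚ_[p], E)) q))
  refine hd.congr_mfderiv ?_
  ext v ξ
  have h3 : (mfderiv (𝓘(ℚ_[p], F).prod 𝓘(ℚ_[p], E)) 𝓘(ℚ_[p], E)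
      (fun q : G × M ↦ q.1 • q.2) q v : E) = (orbitMapDeriv ℚ_[p] F E q.2 q.1 v.1 : E) +
        (mfderiv 𝓘(ℚ_[p], E) 𝓘(ℚ_[p], E) (fun m : M ↦ q.1 • m) q.2 v.2 : E) :=
    mfderiv_prod_eq_add_apply hSq.mdifferentiableAt
  -- A tangent vector of `G × M` splits into a part along the orbit, killed by the orthogonality of
  -- the generators, and a part moved by a fixed group element, on which the two derivatives agree
  -- by invariance.
  have h4 : L1 (mfderiv (𝓘(ℚ_[p], F).prod 𝓘(ℚ_[p], E)) 𝓘(ℚ_[p], E)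
      (fun q : G × M ↦ q.1 • q.2) q v : E) ξ = L2 v.2 ξ := by
    have h5 : Ω.eval (q.1 • q.2) (infinitesimalGenerator (𝕜 := ℚ_[p]) (F := F) (G := G) E ξ
        (q.1 • q.2)) (orbitMapDeriv ℚ_[p] F E q.2 q.1 v.1 : E) = 0 := by
      refine (congrArg (Ω.eval (q.1 • q.2) _) (orbitMapDeriv_apply (F := F) q.2 q.1 v.1)).trans ?_
      exact hX _ _ _
    have h6 : Ω.eval (q.1 • q.2) (infinitesimalGenerator (𝕜 := ℚ_[p]) (F := F) (G := G) E ξ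
        (q.1 • q.2)) (mfderiv 𝓘(ℚ_[p], E) 𝓘(ℚ_[p], E) (fun m : M ↦ q.1 • m) q.2 v.2 : E) =
        L2 v.2 ξ := by
      refine (congrArg (Ω.eval (q.1 • q.2) · _)
        (mfderiv_smul_infinitesimalGenerator (F := F) q.1 q.2 ξ).symm).trans ?_
      exact (hG.eval_smul _ _ _ _).trans (h2 _ _).symm
    exact (h1 _ _).trans ((congrArg (Ω.eval (q.1 • q.2) _) h3).trans
      ((Ω.eval_add_right _ _ _ _).trans ((congrArg₂ (· + ·) h5 h6).trans (zero_add _))))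
  exact sub_eq_zero.2 h4

theorem exists_invariant_isMomentumMapAt [ProperSpace E] [IsUltrametricDist E] [T2Space M]
    {Ω : TwoForm ℚ_[p] E M} (hΩ : IsSymplecticForm Ω)
    (hG : IsSymplecticAction G Ω) (hproper : IsProperAction G M)
    (hX : ∀ (ξ η : GroupLieAlgebra 𝓘(ℚ_[p], F) G) (m : M),
      Ω m ![infinitesimalGenerator E ξ m, infinitesimalGenerator E η m] = 0) (x₀ : M) :
    ∃ (V : Set M) (ν : M → F →L[ℚ_[p]] ℚ_[p]), IsOpen V ∧ IsCompact V ∧ x₀ ∈ V ∧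
      (∀ x ∈ V, IsMomentumMapAt F G Ω ν x) ∧
      ∀ (g : G) (x : M), x ∈ V → g • x ∈ V → ν (g • x) = ν x := by
  have : FirstCountableTopology M := ChartedSpace.firstCountableTopology E M
  obtain ⟨ν, hν⟩ := hΩ.exists_eventually_isMomentumMapAt (F := F) hG x₀
  have hU : ∃ U ∈ 𝓝 x₀, ∀ (g : G) (x : M), x ∈ U → g • x ∈ U → ν (g • x) = ν x := by
    -- Counterexamples in shrinking neighbourhoods have, by properness, a subsequence of group
    -- elements converging to some `h` that fixes `x₀`. This contradicts the local invariance near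
    -- `(h, x₀)`.
    by_contra! hcon
    obtain ⟨B, hB⟩ := (𝓝 x₀).exists_antitone_basis
    choose g x hx hgx hne using fun n ↦ hcon (B n) (hB.mem n)
    have hxlim : Filter.Tendsto x Filter.atTop (𝓝 x₀) := hB.tendsto hx
    have hgxlim : Filter.Tendsto (fun n ↦ g n • x n) Filter.atTop (𝓝 x₀) := hB.tendsto hgx
    obtain ⟨φ, h, hφ, hlim⟩ := hproper g x x₀ x₀ hxlim hgxlim
    have : ContinuousSMul G M :=
      ContMDiffSMul.continuousSMul (I := 𝓘(ℚ_[p], F)) (I' := 𝓘(ℚ_[p], E)) ω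
    have hxφ := hxlim.comp hφ.tendsto_atTop
    have hh : h • x₀ = x₀ :=
      tendsto_nhds_unique (hlim.smul hxφ) (hgxlim.comp hφ.tendsto_atTop)
    obtain ⟨n, hn⟩ := ((hlim.prodMk_nhds hxφ).eventually
      (eventually_smul_eq_of_isMomentumMapAt hG hX hν hh)).exists
    exact hne (φ n) hn
  obtain ⟨U, hU, hUν⟩ := hU
  obtain ⟨V, hVU, hVc, hVo, hxV⟩ :=
    ChartedSpace.exists_isCompact_isOpen_subset (E := E) (Filter.inter_mem hU hν)
  exact ⟨V, ν, hVo, hVc, hxV, fun x hx ↦ (hVU hx).2,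
    fun g x hx hgx ↦ hUν g x (hVU hx).1 (hVU hgx).1⟩

theorem isHamiltonian_of_forall_eval_infinitesimalGenerator [ProperSpace E] [IsUltrametricDist E]
    [T2Space M] [ParacompactSpace M] [TopologicalSpace.SeparableSpace G]
    {Ω : TwoForm ℚ_[p] E M} (hΩ : IsSymplecticForm Ω)
    (hG : IsSymplecticAction G Ω) (hproper : IsProperAction G M)
    (hX : ∀ (ξ η : GroupLieAlgebra 𝓘(ℚ_[p], F) G) (m : M),
      Ω m ![infinitesimalGenerator E ξ m, infinitesimalGenerator E η m] = 0) :
    IsHamiltonian F G Ω := by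
  have : FirstCountableTopology M := ChartedSpace.firstCountableTopology E M
  have : ContinuousSMul G M :=
    ContMDiffSMul.continuousSMul (I := 𝓘(ℚ_[p], F)) (I' := 𝓘(ℚ_[p], E)) ω
  choose V ν hVo hVc hV hν hinv using
    exists_invariant_isMomentumMapAt (F := F) hΩ hG hproper hX
  obtain ⟨s, hs, hsg, hsl⟩ := exists_invariant_locallyConstant_selection (G := G) V hVo hVc hV
    fun a ↦ hproper.isClosed_setOf_exists_smul_mem (hVc a)
  choose g hg using hs
  -- The extension of `ν y` to the saturation of `V y` does not depend on the group element used, so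
  -- the choice of `g` is harmless.
  have hcomp (x y : M) (k l : G) (hx : k • x ∈ V y) (hx' : l • x ∈ V y) :
      ν y (k • x) = ν y (l • x) := by
    have h1 : k • x = (k * l⁻¹) • l • x := by simp [← mul_smul]
    rw [h1] at hx ⊢
    exact hinv y _ _ hx' hx
  refine ⟨fun x ↦ ν (s x) (g x • x), isMomentumMap_of_forall_isMomentumMapAt fun x ↦ ?_,
    fun k x ↦ ?_⟩
  -- Near `x` the selected neighbourhood is constant and the varying `g y` may be replaced by the
  -- fixed `g x`, so the glued map is locally a translate of one local solution.
  · refine ((hν (s x) _ (hg x)).comp_smul hG).congr ?_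
    have h1 : ∀ᶠ y in 𝓝 x, g x • y ∈ V (s x) :=
      (continuous_const_smul (g x)).continuousAt.eventually ((hVo (s x)).mem_nhds (hg x))
    filter_upwards [hsl x, h1] with y hy hgy
    have h2 := hg y
    rw [hy] at h2 ⊢
    exact hcomp y (s x) _ _ h2 hgy
  · have h1 := hg (k • x)
    rw [coAd_eq_self]
    simp only [hsg, ← mul_smul] at h1 ⊢
    exact hcomp x (s x) _ _ h1 (hg x)

end PadicHamiltonian

theorem theoremB (p : ℕ) [Fact p.Prime] (k n : ℕ)
    -- an Abelian, second countable `p`-adic analytic Lie group of dimension `k`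
    (G : Type*) [CommGroup G] [TopologicalSpace G] [T2Space G] [SecondCountableTopology G]
    [ChartedSpace (Fin k → ℚ_[p]) G] [LieGroup 𝓘(ℚ_[p], Fin k → ℚ_[p]) ω G]
    -- a paracompact `p`-adic analytic manifold of dimension `2n`
    (M : Type*) [TopologicalSpace M] [T2Space M] [ParacompactSpace M]
    [ChartedSpace (Fin (2 * n) → ℚ_[p]) M] [IsManifold 𝓘(ℚ_[p], Fin (2 * n) → ℚ_[p]) ω M]
    -- a symplectic form
    (Ω : PadicHamiltonian.TwoForm ℚ_[p] (Fin (2 * n) → ℚ_[p]) M)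
    (hΩ : PadicHamiltonian.IsSymplecticForm Ω)
    -- a proper analytic symplectic action
    [MulAction G M]
    [ContMDiffSMul 𝓘(ℚ_[p], Fin k → ℚ_[p]) 𝓘(ℚ_[p], Fin (2 * n) → ℚ_[p]) ω G M]
    (hsymp : PadicHamiltonian.IsSymplecticAction G Ω)
    (hproper : PadicHamiltonian.IsProperAction G M) :
    (PadicHamiltonian.IsHamiltonian (Fin k → ℚ_[p]) G Ω ↔
      ∀ (ξ η : GroupLieAlgebra 𝓘(ℚ_[p], Fin k → ℚ_[p]) G) (m : M),
        Ω m ![PadicHamiltonian.infinitesimalGenerator (Fin (2 * n) → ℚ_[p]) ξ m,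
          PadicHamiltonian.infinitesimalGenerator (Fin (2 * n) → ℚ_[p]) η m] = 0) ∧
    (PadicHamiltonian.IsHamiltonian (Fin k → ℚ_[p]) G Ω ↔
      ∀ m : M, PadicHamiltonian.IsIsotropicOrbit ℚ_[p] (Fin k → ℚ_[p]) G Ω m) := by
  have h : PadicHamiltonian.IsHamiltonian (Fin k → ℚ_[p]) G Ω ↔
      ∀ (ξ η : GroupLieAlgebra 𝓘(ℚ_[p], Fin k → ℚ_[p]) G) (m : M),
        Ω m ![PadicHamiltonian.infinitesimalGenerator (Fin (2 * n) → ℚ_[p]) ξ m,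
          PadicHamiltonian.infinitesimalGenerator (Fin (2 * n) → ℚ_[p]) η m] = 0 :=
    ⟨fun h ↦ h.eval_infinitesimalGenerator,
      PadicHamiltonian.isHamiltonian_of_forall_eval_infinitesimalGenerator hΩ hsymp hproper⟩
  exact ⟨h, h.trans PadicHamiltonian.isIsotropicOrbit_iff.symm⟩
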